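/- **Notation.** For a real matrix $A$ let $\mathrm{st}(A)=\|A\|_F^2/\|A\|_{\mathrm{op}}^2$ (stable rank; $\mathrm{st}(0):=0$). For $X=[x_1,\dots,x_n]\in\mathbf R^{d\times n}$ let $\mathrm{RMSNorm}(X)$ be the matrix with columns $\sqrt d\,x_t/\|x_t\|_2$. **Transformer at Gaussian initialization.** Let $L,n_{\mathrm{head}},d,k,n\ge 1$ be integers with $n_{\mathrm{head}}\mid d$, and $d_{\mathrm{head}}=d/n_{\mathrm{head}}$. Let $(i_1,\dots,i_n)\in\{1,\dots,V\}^n$ be a fixed token sequence and $p_{\max}=\max_j \frac1n|\{t: i_t=j\}|$. Let $E=[e_1,\dots,e_V]\in\mathbf R^{d\times V}$ have i.i.d. $\mathcal N(0,1)$ entries, and let $X^{(0)}\in\mathbf R^{d\times n}$ have columns $x^{(0)}_t=e_{i_t}$. For $\ell=0,\dots,L-1$ and $h\in\{1,\dots,n_{\mathrm{head}}\}$ let $W_V^{(h,\ell)}\in\mathbf R^{d_{\mathrm{head}}\times d}$ and $W_O^{(\ell)}\in\mathbf R^{d\times d}$ have $\mathcal N(0,1/d)$ entries and $W_2^{(\ell)}\in\mathbf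 R^{d\times k}$ have $\mathcal N(0,1/k)$ entries, all entries of $E$ and of all these matrices being mutually independent. Let $P^{(h,\ell)}\in\mathbf R^{n\times n}$ be random matrices whose columns are probability vectors, let $B^{(\ell)}=[b^{(\ell)}_1,\dots,b^{(\ell)}_n]\in\mathbf R^{k\times n}$ be random matrices, and define $$A^{\mathrm{rms},(\ell)}=\mathrm{RMSNorm}(X^{(\ell)}),\qquad H^{(\ell)}=\mathrm{Concat}_h\bigl(W_V^{(h,\ell)}A^{\mathrm{rms},(\ell)}P^{(h,\ell)}\bigr),\qquad X^{\mathrm{att},(\ell)}=X^{(\ell)}+W_O^{(\ell)}H^{(\ell)},$$ $$A^{\mathrm{rms},(\ell)}_{\mathrm{mlp}}=\mathrm{RMSNorm}(X^{\mathrm{att},(\ell)}),\qquad X^{(\ell+1)}=X^{\mathrm{att},(\ell)}+W_2^{(\ell)}B^{(\ell)},\qquad A^{\mathrm{rms}}_{\mathrm{final}}=\mathrm{RMSNorm}(X^{(L)}),$$ where $\mathrm{Concat}_h$ stacks the $n_{\mathrm{head}}$ blocks vertically. Assume that for each $\ell$ the pair $\bigl(X^{(\ell)},(P^{(h,\ell)})_h\bigr)$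 is independent of $\bigl((W_V^{(h,\ell)})_h,W_O^{(\ell)},W_2^{(\ell)}\bigr)$, and the pair $(X^{\mathrm{att},(\ell)},B^{(\ell)})$ is independent of $W_2^{(\ell)}$. **Propagation interface.** Let $C_{\mathrm{PROP}}\ge 1$, $m_*\ge 0$ and $P_{\mathrm{PROP}}\in[0,1]$ be such that for each $\ell=0,\dots,L-1$, with probability at least $P_{\mathrm{PROP}}$, $$\mathrm{st}(B^{(\ell)})\le C_{\mathrm{PROP}}\,\mathrm{st}\bigl(A^{\mathrm{rms},(\ell)}_{\mathrm{mlp}}\bigr)\quad\text{and}\quad \|b^{(\ell)}_t\|_2^2\le m_*k\ \text{ for all } t.$$ **Theorem.** Set $\rho:=3.1(1+m_*)$. There exist numerical constants $c,C>0$ (depending on nothing) such that in the above setting, whenever $d\ge CL^2\log(nL)$ and $k\ge CL^2\log(nL)$, with probability at least $$1-CL\exp\!\Bigl(-c\,\frac d{L^2}\Bigr)-L\,(1-P_{\mathrm{PROP}})$$ all of the following hold simultaneously: (i) $\mathrm{st}(X^{(0)})\le \dfrac{1.01}{p_{\max}}$, $\ \mathrm{st}(A^{\mathrm{rms},(0)})\le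 \dfrac{1.03}{p_{\max}}$, $\ \mathrm{st}(A^{\mathrm{rms},(0)}_{\mathrm{mlp}})\le \dfrac{6.03}{p_{\max}}$; (ii) for every $\ell=0,\dots,L-1$, $$\mathrm{st}(A^{\mathrm{rms},(\ell)})\le \bigl(1.02+1.02(1+m_*)\ell\bigr)\frac{1.01}{p_{\max}}\rho^\ell,\qquad \mathrm{st}(A^{\mathrm{rms},(\ell)}_{\mathrm{mlp}})\le \bigl(6.13+3.09(1+m_*)\ell\bigr)\frac{1.01}{p_{\max}}\rho^\ell,$$ $$\mathrm{st}(B^{(\ell)})\le C_{\mathrm{PROP}}\bigl(6.13+3.09(1+m_*)\ell\bigr)\frac{1.01}{p_{\max}}\rho^\ell,$$ and $$\mathrm{st}(A^{\mathrm{rms}}_{\mathrm{final}})\le \bigl(1.02+1.02(1+m_*)L\bigr)\frac{1.01}{p_{\max}}\rho^L.$$ -/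

import Mathlib

open MeasureTheory ProbabilityTheory

noncomputable section

namespace StableRank

/-- The spectral norm of a real matrix: its operator norm with respect to Euclidean norms. -/
def opNorm {d n : ℕ} (A : Matrix (Fin d) (Fin n) ℝ) : ℝ :=
  ‖(Matrix.toEuclideanLin A).toContinuousLinearMap‖

/-- The squared Frobenius norm. -/
def frobSq {d n : ℕ} (A : Matrix (Fin d) (Fin n) ℝ) : ℝ :=
  ∑ i, ∑ j, A i j ^ 2

/-- The stable rank `‖A‖_F² / ‖A‖_op²`. -/
def stableRank {d n : ℕ} (A : Matrix (Fin d) (Fin n) ℝ) : ℝ :=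
  frobSq A / opNorm A ^ 2

/-- The squared Euclidean norm of the `t`-th column. -/
def colNormSq {d n : ℕ} (A : Matrix (Fin d) (Fin n) ℝ) (t : Fin n) : ℝ :=
  ∑ i, A i t ^ 2

/-- RMS normalization: every column `x_t` is replaced by `√d · x_t / ‖x_t‖₂`. -/
def rmsNorm {d n : ℕ} (X : Matrix (Fin d) (Fin n) ℝ) : Matrix (Fin d) (Fin n) ℝ :=
  fun i t => √(d : ℝ) * (X i t / √(colNormSq X t))

/-- Vertical stacking of `nHead` blocks of height `d / nHead` into a matrix with `d` rows. -/
def concatHeads {d nHead n : ℕ} (hdvd : nHead ∣ d)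
    (H : Fin nHead → Matrix (Fin (d / nHead)) (Fin n) ℝ) : Matrix (Fin d) (Fin n) ℝ :=
  fun i t =>
    let q : Fin nHead × Fin (d / nHead) :=
      finProdFinEquiv.symm (Fin.cast (Nat.mul_div_cancel' hdvd).symm i)
    H q.1 q.2 t

/-- Empirical frequency of the most common token of the sequence `tok`. -/
def pMax {n V : ℕ} (tok : Fin n → Fin V) : ℝ :=
  ⨆ j : Fin V, ((Finset.univ.filter fun t => tok t = j).card : ℝ) / n

/-- The ingredients of a transformer with vocabulary size `V`, width `d`, `nHead` heads, MLP
width `k`, on a token sequence of length `n`: the tokens, and the random matrices on the sample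
space `Ω`. Layers are indexed by `ℕ`; only the layers `ℓ < L` are ever used for depth `L`. -/
structure Transformer (Ω : Type*) (V d nHead k n : ℕ) where
  /-- The number of heads divides the width. -/
  head_dvd : nHead ∣ d
  /-- The (deterministic) token sequence. -/
  tok : Fin n → Fin V
  /-- Embedding matrix. -/
  E : Ω → Matrix (Fin d) (Fin V) ℝ
  /-- Attention mixing matrices. -/
  P : ℕ → Fin nHead → Ω → Matrix (Fin n) (Fin n) ℝ
  /-- Value projections. -/
  WV : ℕ → Fin nHead → Ω → Matrix (Fin (d / nHead)) (Fin d) ℝ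
  /-- Output projections. -/
  WO : ℕ → Ω → Matrix (Fin d) (Fin d) ℝ
  /-- MLP output weights. -/
  W2 : ℕ → Ω → Matrix (Fin d) (Fin k) ℝ
  /-- MLP post-activations. -/
  B : ℕ → Ω → Matrix (Fin k) (Fin n) ℝ

/-- Indices of the scalar Gaussian weights of the first `L` layers and of the embedding. -/
inductive WeightIdx (L V d nHead k : ℕ) : Type
  | embed (i : Fin d) (j : Fin V)
  | value (ℓ : Fin L) (h : Fin nHead) (i : Fin (d / nHead)) (j : Fin d)
  | out (ℓ : Fin L) (i : Fin d) (j : Fin d)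
  | mlp (ℓ : Fin L) (i : Fin d) (j : Fin k)

/-- Variances: `1` for the embedding, the inverse input dimension for all other weights. -/
def weightVar {L V d nHead k : ℕ} : WeightIdx L V d nHead k → NNReal
  | .embed _ _ => 1
  | .value _ _ _ _ => (d : NNReal)⁻¹
  | .out _ _ _ => (d : NNReal)⁻¹
  | .mlp _ _ _ => (k : NNReal)⁻¹

namespace Transformer

variable {Ω : Type*} {V d nHead k n : ℕ} (T : Transformer Ω V d nHead k n)

/-- The embedding matrix `X⁽⁰⁾` of the token sequence; its `t`-th column is `e_{i_t}`. -/
def embedded (ω : Ω) : Matrix (Fin d) (Fin n) ℝ :=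
  fun i t => T.E ω i (T.tok t)

/-- The attention sublayer `X ↦ X + W_O · Concat_h (W_V⁽ʰ⁾ · RMSNorm(X) · P⁽ʰ⁾)` of layer `ℓ`. -/
def attention (ℓ : ℕ) (ω : Ω) (X : Matrix (Fin d) (Fin n) ℝ) : Matrix (Fin d) (Fin n) ℝ :=
  X + T.WO ℓ ω * concatHeads T.head_dvd fun h => T.WV ℓ h ω * (rmsNorm X * T.P ℓ h ω)

/-- The hidden states `X⁽ˡ⁾`. -/
def hidden : ℕ → Ω → Matrix (Fin d) (Fin n) ℝ
  | 0, ω => T.embedded ω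
  | ℓ + 1, ω => T.attention ℓ ω (hidden ℓ ω) + T.W2 ℓ ω * T.B ℓ ω

/-- The attention output `X^{att,(ℓ)}`. -/
def hiddenAtt (ℓ : ℕ) (ω : Ω) : Matrix (Fin d) (Fin n) ℝ :=
  T.attention ℓ ω (T.hidden ℓ ω)

/-- `A^{rms,(ℓ)}`; for `ℓ = L` this is `A^{rms}_{final}`. -/
def rms (ℓ : ℕ) (ω : Ω) : Matrix (Fin d) (Fin n) ℝ :=
  rmsNorm (T.hidden ℓ ω)

/-- `A^{rms,(ℓ)}_{mlp}`. -/
def rmsMlp (ℓ : ℕ) (ω : Ω) : Matrix (Fin d) (Fin n) ℝ :=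
  rmsNorm (T.hiddenAtt ℓ ω)

/-- The scalar weights as real random variables. -/
def weight {L : ℕ} : WeightIdx L V d nHead k → Ω → ℝ
  | .embed i j => fun ω => T.E ω i j
  | .value ℓ h i j => fun ω => T.WV ℓ h ω i j
  | .out ℓ i j => fun ω => T.WO ℓ ω i j
  | .mlp ℓ i j => fun ω => T.W2 ℓ ω i j

/-- The first `L` layers are at Gaussian initialization. -/
structure GaussianInit [MeasurableSpace Ω] (μ : Measure Ω) (L : ℕ) : Prop where
  measurable_weight : ∀ w : WeightIdx L V d nHead k, Measurable (T.weight w)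
  measurable_P : ∀ ℓ < L, ∀ h i t, Measurable fun ω => T.P ℓ h ω i t
  measurable_B : ∀ ℓ < L, ∀ i t, Measurable fun ω => T.B ℓ ω i t
  /-- All weights are mutually independent. -/
  indep : iIndepFun (fun w : WeightIdx L V d nHead k => T.weight w) μ
  /-- All weights are centered Gaussians with the prescribed variances. -/
  law : ∀ w : WeightIdx L V d nHead k, μ.map (T.weight w) = gaussianReal 0 (weightVar w)
  /-- The columns of the mixing matrices are probability vectors. -/
  stochastic : ∀ ℓ < L, ∀ h ω t, (fun i => T.P ℓ h ω i t) ∈ stdSimplex ℝ (Fin n)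
  /-- At each layer the mixing matrices, together with the block input they act on, are
  independent of the Gaussian weights of that layer. -/
  indep_P : ∀ ℓ < L,
    IndepFun
      (fun ω => ((fun i t => T.hidden ℓ ω i t, fun h i t => T.P ℓ h ω i t) :
        (Fin d → Fin n → ℝ) × (Fin nHead → Fin n → Fin n → ℝ)))
      (fun ω => ((fun h i j => T.WV ℓ h ω i j, fun i j => T.WO ℓ ω i j,
          fun i j => T.W2 ℓ ω i j) :
        (Fin nHead → Fin (d / nHead) → Fin d → ℝ) × (Fin d → Fin d → ℝ) ×
          (Fin d → Fin k → ℝ))) μ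
  /-- At each layer the MLP post-activation, together with the residual input to which
  `W₂ B` is added, is independent of `W₂`. -/
  indep_B : ∀ ℓ < L,
    IndepFun
      (fun ω => ((fun i t => T.hiddenAtt ℓ ω i t, fun i t => T.B ℓ ω i t) :
        (Fin d → Fin n → ℝ) × (Fin k → Fin n → ℝ)))
      (fun ω => ((fun i j => T.W2 ℓ ω i j) : Fin d → Fin k → ℝ)) μ

end Transformer

/-- The propagation interface for a random intermediate `B` fed by the input `X`: with
probability at least `p`, `st(B) ≤ Cprop · st(RMSNorm X)` and all squared column norms of `B`
are at most `m * k`. -/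
structure PropagationInterface {Ω : Type*} [MeasurableSpace Ω] (μ : Measure Ω) {d k n : ℕ}
    (X : Ω → Matrix (Fin d) (Fin n) ℝ) (B : Ω → Matrix (Fin k) (Fin n) ℝ)
    (Cprop m p : ℝ) : Prop where
  one_le_Cprop : 1 ≤ Cprop
  m_nonneg : 0 ≤ m
  p_nonneg : 0 ≤ p
  p_le_one : p ≤ 1
  prob : p ≤ μ.real {ω | stableRank (B ω) ≤ Cprop * stableRank (rmsNorm (X ω)) ∧
    ∀ t, colNormSq (B ω) t ≤ m * k}

end StableRank

end

/-!
Let `u` be the indicator of the positions of the most frequent token. A bound `R` on the squared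
column norms of `X` gives `‖X‖_F² ≤ n * R`, and `‖X u‖² / ‖u‖²` bounds `‖X‖_op²` from below, so the
stable rank of `X` is at most `n * R * ‖u‖² / ‖X u‖²`. The same bound holds for `RMSNorm X`: test it
on `u` reweighted by the column norms of `X`, which undoes the normalization.

Every sublayer adds `G * H` with `G` Gaussian and independent of `X` and `H`. Conditionally on
these, `‖(X + G * H) u‖²` concentrates around a mean at least `‖X u‖²`, so the direction `u` never
loses mass, while the squared column norms grow by at most the mean squared column norms of
`G * H`, which are of order `d` for attention and `d * m` for the MLP. With relative error
`ε = 1 / (1000 * L)` per sublayer the accumulated loss stays below a factor `1.01`, so the stable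
ranks grow only linearly with depth, from their value of order `1 / p_max` for the embedding.
-/

open scoped Matrix

noncomputable section

namespace StableRank

section GaussianSquares

variable {a l : ℝ} {v : NNReal}

-- Completing the square in the exponent turns `N(a, v)` into a Gaussian of variance `v / q`.
lemma exp_mul_sq_mul_gaussianPDFReal {q : ℝ} {w : NNReal} (hv : v ≠ 0) (hq : 0 < q)
    (hlv : q = 1 - 2 * l * v) (hw : (w : ℝ) = v / q) (x : ℝ) :
    Real.exp (l * x ^ 2) * gaussianPDFReal a v x =
      Real.exp (l * a ^ 2 / q) / √q * gaussianPDFReal (a / q) w x := by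
  have hv' : (v : ℝ) ≠ 0 := by exact_mod_cast hv
  have hl : l = (1 - q) / (2 * v) := by rw [hlv]; field_simp; ring
  have hnormalize : (√(2 * Real.pi * w))⁻¹ = √q * (√(2 * Real.pi * v))⁻¹ := by
    rw [hw, ← mul_div_assoc, Real.sqrt_div' _ hq.le, inv_div, div_eq_mul_inv]
  have hexponent : l * x ^ 2 + -(x - a) ^ 2 / (2 * v) =
      l * a ^ 2 / q + -(x - a / q) ^ 2 / (2 * w) := by
    rw [hl, hw]
    field_simp
    ring
  calc Real.exp (l * x ^ 2) * gaussianPDFReal a v x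
      = (√(2 * Real.pi * v))⁻¹ * Real.exp (l * x ^ 2 + -(x - a) ^ 2 / (2 * v)) := by
        rw [gaussianPDFReal, Real.exp_add]; ring
    _ = Real.exp (l * a ^ 2 / q) / √q * gaussianPDFReal (a / q) w x := by
        rw [hexponent, Real.exp_add, gaussianPDFReal, hnormalize]
        field_simp [(Real.sqrt_pos.2 hq).ne']

lemma mgf_sq_gaussianReal (h : 2 * l * v < 1) :
    mgf (fun x => x ^ 2) (gaussianReal a v) l =
      Real.exp (l * a ^ 2 / (1 - 2 * l * v)) / √(1 - 2 * l * v) := by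
  rcases eq_or_ne v 0 with rfl | hv
  · simp [mgf]
  have hq : 0 < 1 - 2 * l * v := by linarith
  obtain ⟨w, hw⟩ : ∃ w : NNReal, (w : ℝ) = v / (1 - 2 * l * v) :=
    ⟨⟨v / (1 - 2 * l * v), by positivity⟩, rfl⟩
  have hw0 : w ≠ 0 := by
    rw [← NNReal.coe_ne_zero, hw]
    exact div_ne_zero (NNReal.coe_ne_zero.2 hv) hq.ne'
  rw [mgf, integral_gaussianReal_eq_integral_smul hv]
  simp_rw [smul_eq_mul, mul_comm (gaussianPDFReal a v _),
    exp_mul_sq_mul_gaussianPDFReal hv hq rfl hw]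
  rw [integral_const_mul, integral_gaussianPDFReal_eq_one _ hw0, mul_one]

lemma neg_log_one_sub_le {x : ℝ} (hx : |x| ≤ 1 / 2) : -Real.log (1 - x) ≤ x + 2 * x ^ 2 := by
  have hlog := (abs_le.1 (Real.abs_log_sub_add_sum_range_le (by linarith : |x| < 1) 1)).1
  have hrem : |x| ^ 2 / (1 - |x|) ≤ 2 * x ^ 2 := by
    rw [sq_abs, div_le_iff₀ (by linarith)]
    nlinarith [sq_nonneg x]
  simp only [Finset.range_one, Finset.sum_singleton, Nat.cast_zero, zero_add, pow_one, div_one,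
    Nat.reduceAdd] at hlog
  linarith

lemma mgf_sq_gaussianReal_le (h : 4 * |l| * v ≤ 1) :
    mgf (fun x => x ^ 2) (gaussianReal a v) l ≤
      Real.exp ((l + 4 * l ^ 2 * v) * (a ^ 2 + v)) := by
  have hx : |2 * l * v| ≤ 1 / 2 := by
    rw [abs_mul, abs_mul, abs_two, NNReal.abs_eq]
    linarith
  have hq : 0 < 1 - 2 * l * v := by linarith [(abs_le.1 hx).2]
  have hsqrt : (√(1 - 2 * l * v))⁻¹ = Real.exp (-Real.log (1 - 2 * l * v) / 2) := by
    rw [neg_div, Real.exp_neg, ← Real.log_sqrt hq.le, Real.exp_log (Real.sqrt_pos.2 hq)]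
  have hmean : l * a ^ 2 / (1 - 2 * l * v) ≤ (l + 4 * l ^ 2 * v) * a ^ 2 := by
    rw [div_le_iff₀ hq]
    have h0 : 0 ≤ l ^ 2 * v * a ^ 2 := by positivity
    linarith [mul_le_mul_of_nonneg_left (abs_le.1 hx).2 h0]
  rw [mgf_sq_gaussianReal (by linarith), div_eq_mul_inv, hsqrt, ← Real.exp_add, Real.exp_le_exp]
  linarith [neg_log_one_sub_le hx]

variable {Ω ι : Type*} [MeasurableSpace Ω] {μ : Measure Ω} [Fintype ι] {Y : ι → Ω → ℝ}
  {m : ι → ℝ} {w : ι → NNReal} {s ε N : ℝ}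

lemma mgf_sum_sq_eq_prod (hind : iIndepFun Y μ)
    (hY : ∀ i, HasLaw (Y i) (gaussianReal (m i) (w i)) μ) :
    mgf (fun ω => ∑ i, Y i ω ^ 2) μ l =
      ∏ i, mgf (fun x => x ^ 2) (gaussianReal (m i) (w i)) l := by
  have hsum := (hind.comp (fun _ x => x ^ 2) fun _ => by fun_prop).mgf_sum₀ (t := l)
    (fun i => (hY i).aemeasurable.pow_const 2) Finset.univ
  convert hsum using 1
  · congr 1
    ext ω
    simp
  · refine Finset.prod_congr rfl fun i _ => ?_
    rw [← (hY i).map_eq, mgf_map (hY i).aemeasurable (by fun_prop)]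

lemma mgf_sum_sq_le (hind : iIndepFun Y μ)
    (hY : ∀ i, HasLaw (Y i) (gaussianReal (m i) (w i)) μ) (hw : ∀ i, w i ≤ s)
    (hl : 4 * |l| * s ≤ 1) :
    mgf (fun ω => ∑ i, Y i ω ^ 2) μ l ≤
      Real.exp ((l + 4 * l ^ 2 * s) * ∑ i, (m i ^ 2 + w i)) := by
  rw [mgf_sum_sq_eq_prod hind hY, Finset.mul_sum, Real.exp_sum]
  refine Finset.prod_le_prod (fun i _ => mgf_nonneg) fun i _ =>
    (mgf_sq_gaussianReal_le ?_).trans (Real.exp_le_exp.2 ?_)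
  · exact (mul_le_mul_of_nonneg_left (hw i) (by positivity)).trans hl
  · gcongr
    exact hw i

lemma integrable_exp_mul_sum_sq (hind : iIndepFun Y μ)
    (hY : ∀ i, HasLaw (Y i) (gaussianReal (m i) (w i)) μ) (hl : ∀ i, 2 * l * w i < 1) :
    Integrable (fun ω => Real.exp (l * ∑ i, Y i ω ^ 2)) μ := by
  refine .of_integral_ne_zero ?_
  change mgf (fun ω => ∑ i, Y i ω ^ 2) μ l ≠ 0
  rw [mgf_sum_sq_eq_prod hind hY, Finset.prod_ne_zero_iff]
  intro i _
  rw [mgf_sq_gaussianReal (hl i)]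
  exact (div_pos (Real.exp_pos _) (Real.sqrt_pos.2 (by linarith [hl i]))).ne'

lemma measureReal_le_sum_sq_le (hind : iIndepFun Y μ)
    (hY : ∀ i, HasLaw (Y i) (gaussianReal (m i) (w i)) μ) (hs : 0 < s) (hw : ∀ i, w i ≤ s)
    (hε0 : 0 ≤ ε) (hε1 : ε ≤ 1) (hN : ∑ i, (m i ^ 2 + w i) ≤ N) :
    μ.real {ω | (1 + ε) * N ≤ ∑ i, Y i ω ^ 2} ≤ Real.exp (-(ε ^ 2 * N / (16 * s))) := by
  have := hind.isProbabilityMeasure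
  set l : ℝ := ε / (8 * s) with hl
  have hl0 : 0 ≤ l := by positivity
  have hls : l * s = ε / 8 := by rw [hl]; field_simp
  have hint : Integrable (fun ω => Real.exp (l * ∑ i, Y i ω ^ 2)) μ :=
    integrable_exp_mul_sum_sq hind hY fun i => by
      linarith [mul_le_mul_of_nonneg_left (hw i) hl0]
  have hmgf := mgf_sum_sq_le (l := l) hind hY hw (by rw [abs_of_nonneg hl0]; linarith)
  calc μ.real {ω | (1 + ε) * N ≤ ∑ i, Y i ω ^ 2}
      ≤ Real.exp (-l * ((1 + ε) * N)) *
          Real.exp ((l + 4 * l ^ 2 * s) * ∑ i, (m i ^ 2 + w i)) :=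
        (measure_ge_le_exp_mul_mgf _ hl0 hint).trans
          (mul_le_mul_of_nonneg_left hmgf (Real.exp_pos _).le)
    _ ≤ Real.exp (-l * ((1 + ε) * N)) * Real.exp ((l + 4 * l ^ 2 * s) * N) := by gcongr
    _ = Real.exp (-(ε ^ 2 * N / (16 * s))) := by
        rw [← Real.exp_add, hl]
        congr 1
        field_simp
        ring

lemma measureReal_sum_sq_le_le (hind : iIndepFun Y μ)
    (hY : ∀ i, HasLaw (Y i) (gaussianReal (m i) (w i)) μ) (hs : 0 < s) (hw : ∀ i, w i ≤ s)
    (hε0 : 0 ≤ ε) (hε1 : ε ≤ 1) :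
    μ.real {ω | ∑ i, Y i ω ^ 2 ≤ (1 - ε) * ∑ i, (m i ^ 2 + w i)} ≤
      Real.exp (-(ε ^ 2 * (∑ i, (m i ^ 2 + w i)) / (16 * s))) := by
  have := hind.isProbabilityMeasure
  set l : ℝ := -(ε / (8 * s)) with hl
  have hl0 : l ≤ 0 := neg_nonpos.2 (by positivity)
  have hls : l * s = -(ε / 8) := by rw [hl]; field_simp
  have hint : Integrable (fun ω => Real.exp (l * ∑ i, Y i ω ^ 2)) μ :=
    integrable_exp_mul_sum_sq hind hY fun i => by
      linarith [mul_nonpos_of_nonpos_of_nonneg hl0 (w i).coe_nonneg]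
  have hmgf := mgf_sum_sq_le (l := l) hind hY hw (by rw [abs_of_nonpos hl0]; linarith)
  calc μ.real {ω | ∑ i, Y i ω ^ 2 ≤ (1 - ε) * ∑ i, (m i ^ 2 + w i)}
      ≤ Real.exp (-l * ((1 - ε) * ∑ i, (m i ^ 2 + w i))) *
          Real.exp ((l + 4 * l ^ 2 * s) * ∑ i, (m i ^ 2 + w i)) :=
        (measure_le_le_exp_mul_mgf _ hl0 hint).trans
          (mul_le_mul_of_nonneg_left hmgf (Real.exp_pos _).le)
    _ = Real.exp (-(ε ^ 2 * (∑ i, (m i ^ 2 + w i)) / (16 * s))) := by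
        rw [← Real.exp_add, hl]
        congr 1
        field_simp
        ring

end GaussianSquares

/-- The squared Euclidean norm of a vector of reals. -/
def sqNorm {ι : Type*} [Fintype ι] (x : ι → ℝ) : ℝ :=
  ∑ i, x i ^ 2

section SqNorm

variable {ι : Type*} [Fintype ι] {x : ι → ℝ}

lemma sqNorm_nonneg (x : ι → ℝ) : 0 ≤ sqNorm x :=
  Finset.sum_nonneg fun _ _ => sq_nonneg _

@[simp]
lemma sqNorm_eq_zero : sqNorm x = 0 ↔ x = 0 := by
  simp [sqNorm, Finset.sum_eq_zero_iff_of_nonneg fun _ _ => sq_nonneg _, funext_iff]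

@[fun_prop]
lemma measurable_sqNorm : Measurable (sqNorm : (ι → ℝ) → ℝ) := by
  unfold sqNorm
  fun_prop

lemma coe_mul_toNNReal_sqNorm (v : NNReal) (x : ι → ℝ) :
    ((v * (sqNorm x).toNNReal : NNReal) : ℝ) = v * sqNorm x := by
  rw [NNReal.coe_mul, Real.coe_toNNReal _ (sqNorm_nonneg x)]

end SqNorm

section Indep

variable {Ω α β γ : Type*} [MeasurableSpace Ω] [MeasurableSpace α] [MeasurableSpace β]
  [MeasurableSpace γ] {μ : Measure Ω} {X : Ω → α} {Y : Ω → β} {Z : Ω → γ}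

lemma measureReal_le_of_indepFun [IsProbabilityMeasure μ] (h : IndepFun X Y μ)
    (hX : Measurable X) (hY : Measurable Y) {s : Set (α × β)} (hs : MeasurableSet s) {δ : ℝ}
    (hδ : ∀ ω, μ.real {ω' | (X ω, Y ω') ∈ s} ≤ δ) :
    μ.real {ω | (X ω, Y ω) ∈ s} ≤ δ := by
  have hδ0 : 0 ≤ δ := by
    obtain ⟨ω⟩ : Nonempty Ω := nonempty_of_isProbabilityMeasure μ
    exact measureReal_nonneg.trans (hδ ω)
  have hlaw : μ {ω | (X ω, Y ω) ∈ s} = ((μ.map X).prod (μ.map Y)) s := by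
    rw [← h.map_prod_eq_prod_map_map hX.aemeasurable hY.aemeasurable,
      Measure.map_apply (hX.prodMk hY) hs]
    rfl
  have hbound : μ {ω | (X ω, Y ω) ∈ s} ≤ ENNReal.ofReal δ := by
    rw [hlaw, Measure.prod_apply hs, lintegral_map (measurable_measure_prodMk_left hs) hX]
    calc ∫⁻ ω, μ.map Y (Prod.mk (X ω) ⁻¹' s) ∂μ ≤ ∫⁻ _, ENNReal.ofReal δ ∂μ :=
          lintegral_mono fun ω => by
            rw [Measure.map_apply hY (measurable_prodMk_left hs)]
            exact (ENNReal.le_ofReal_iff_toReal_le (measure_ne_top _ _) hδ0).2 (hδ ω)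
      _ = ENNReal.ofReal δ := by simp
  exact ENNReal.toReal_le_of_le_ofReal hδ0 hbound

lemma indepFun_prodMk_left_of_prodMk_right [IsFiniteMeasure μ]
    (h : IndepFun X (fun ω => (Y ω, Z ω)) μ) (hYZ : IndepFun Y Z μ) (hX : AEMeasurable X μ)
    (hY : AEMeasurable Y μ) (hZ : AEMeasurable Z μ) :
    IndepFun (fun ω => (X ω, Y ω)) Z μ := by
  have hXY : IndepFun X Y μ := h.comp measurable_id measurable_fst
  have hlaw := h.map_prod_eq_prod_map_map hX (hY.prodMk hZ)
  rw [hYZ.map_prod_eq_prod_map_map hY hZ] at hlaw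
  rw [indepFun_iff_map_prod_eq_prod_map_map (hX.prodMk hY) hZ,
    hXY.map_prod_eq_prod_map_map hX hY,
    ← MeasurableEquiv.prodAssoc.map_measurableEquiv_injective.eq_iff, Measure.prodAssoc_prod,
    ← hlaw, AEMeasurable.map_map_of_aemeasurable (by fun_prop) ((hX.prodMk hY).prodMk hZ)]
  rfl

lemma iIndepFun_curry {ι κ : Type*} {X : ι → κ → Ω → α}
    (hX : ∀ i j, Measurable (X i j)) (h : iIndepFun (fun p : ι × κ => X p.1 p.2) μ) :
    iIndepFun (fun i ω j => X i j ω) μ := by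
  have := h.isProbabilityMeasure
  have : ∀ i j, IsProbabilityMeasure (μ.map (X i j)) :=
    fun i j => Measure.isProbabilityMeasure_map (hX i j).aemeasurable
  have hrow : ∀ i, iIndepFun (X i) μ := fun i =>
    h.precomp (g := fun j => (i, j)) fun _ _ hj => congrArg Prod.snd hj
  have hcurry : (MeasurableEquiv.curry ι κ α) ∘ (fun ω p => X p.1 p.2 ω) =
      fun ω i j => X i j ω := rfl
  rw [iIndepFun_iff_map_fun_eq_infinitePi_map (by fun_prop), ← hcurry,
    ← Measure.map_map (by fun_prop) (by fun_prop),
    (iIndepFun_iff_map_fun_eq_infinitePi_map (by fun_prop)).1 h,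
    Measure.infinitePi_map_curry (fun i j => μ.map (X i j))]
  congrm Measure.infinitePi fun i => ?_
  rw [(iIndepFun_iff_map_fun_eq_infinitePi_map (by fun_prop)).1 (hrow i)]

lemma hasLaw_sum_gaussianReal {κ : Type*} [Fintype κ] {Y : κ → Ω → ℝ} {m : κ → ℝ}
    {v : κ → NNReal} (hind : iIndepFun Y μ)
    (hY : ∀ j, HasLaw (Y j) (gaussianReal (m j) (v j)) μ) :
    HasLaw (fun ω => ∑ j, Y j ω) (gaussianReal (∑ j, m j) (∑ j, v j)) μ := by
  have := hind.isProbabilityMeasure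
  have hmeas : ∀ j, AEMeasurable (Y j) μ := fun j => (hY j).aemeasurable
  have hsum : (fun ω => ∑ j, Y j ω) = ∑ j, Y j := by ext; simp
  refine ⟨by fun_prop, ?_⟩
  rw [hsum]
  have := Measure.isProbabilityMeasure_map (μ := μ) (f := ∑ j, Y j) (by fun_prop)
  apply Measure.ext_of_charFun
  rw [iIndepFun.charFun_map_sum_eq_prod hmeas hind]
  ext t
  simp only [Finset.prod_apply, fun j => (hY j).map_eq, charFun_gaussianReal,
    ← Complex.exp_sum]
  congr 1
  push_cast
  simp only [Finset.mul_sum, Finset.sum_mul, Finset.sum_div, Finset.sum_sub_distrib]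

end Indep

/-- The entries of the random matrix `G` are independent `N(0, v)` variables. -/
structure IsGaussianMatrix {Ω ι κ : Type*} [MeasurableSpace Ω] (μ : Measure Ω)
    (G : Ω → Matrix ι κ ℝ) (v : NNReal) : Prop where
  measurable : ∀ i j, Measurable fun ω => G ω i j
  indep : iIndepFun (fun (p : ι × κ) ω => G ω p.1 p.2) μ
  law : ∀ i j, μ.map (fun ω => G ω i j) = gaussianReal 0 v

namespace IsGaussianMatrix

variable {Ω ι κ : Type*} [MeasurableSpace Ω] {μ : Measure Ω} [Fintype κ]
  {G : Ω → Matrix ι κ ℝ} {v : NNReal} {ε : ℝ}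

lemma indep_affine_rows (hG : IsGaussianMatrix μ G v) (x : ι → ℝ) (b : ι → κ → ℝ) :
    iIndepFun (fun i ω => x i + G ω i ⬝ᵥ b i) μ :=
  (iIndepFun_curry hG.measurable hG.indep).comp (fun i g => x i + g ⬝ᵥ b i) fun i => by
    unfold dotProduct
    fun_prop

lemma hasLaw_affine_row (hG : IsGaussianMatrix μ G v) (x : ℝ) (b : κ → ℝ) (i : ι) :
    HasLaw (fun ω => x + G ω i ⬝ᵥ b) (gaussianReal x (v * (sqNorm b).toNNReal)) μ := by
  have hrow : iIndepFun (fun j ω => G ω i j) μ :=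
    hG.indep.precomp (g := fun j => (i, j)) fun _ _ h => congrArg Prod.snd h
  have hsum := hasLaw_sum_gaussianReal (hrow.comp (fun j g => g * b j) fun j => by fun_prop)
    fun j => gaussianReal_mul_const ⟨(hG.measurable i j).aemeasurable, hG.law i j⟩ (b j)
  have hvar : v * (sqNorm b).toNNReal = ∑ j, .mk (b j ^ 2) (sq_nonneg _) * v := by
    rw [← NNReal.coe_inj, coe_mul_toNNReal_sqNorm, ← Finset.sum_mul, mul_comm]
    simp [sqNorm]
  rw [hvar]
  simpa [dotProduct] using gaussianReal_const_add hsum x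

variable [Fintype ι]

lemma measureReal_affine_rows_upper_le (hG : IsGaussianMatrix μ G v) (hv : v ≠ 0)
    (hε0 : 0 ≤ ε) (hε1 : ε ≤ 1) (x : ι → ℝ) (b : ι → κ → ℝ) {s : ℝ}
    (hs : ∀ i, v * sqNorm (b i) ≤ s) :
    μ.real {ω | sqNorm x + Fintype.card ι * s <
        (1 - ε) * sqNorm fun i => x i + G ω i ⬝ᵥ b i} ≤
      Real.exp (-(ε ^ 2 * Fintype.card ι / 16)) := by
  rcases isEmpty_or_nonempty ι with hι | ⟨⟨i₀⟩⟩
  · simp [sqNorm]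
  have := hG.indep.isProbabilityMeasure
  have hcard : (0 : ℝ) < Fintype.card ι := by exact_mod_cast Fintype.card_pos_iff.2 ⟨i₀⟩
  have hs0 : 0 ≤ s := (mul_nonneg v.coe_nonneg (sqNorm_nonneg _)).trans (hs i₀)
  have hx0 := sqNorm_nonneg x
  set N := sqNorm x + Fintype.card ι * s with hN
  have hmean : ∑ i, (x i ^ 2 + ((v * (sqNorm (b i)).toNNReal : NNReal) : ℝ)) ≤ N := by
    simp only [coe_mul_toNNReal_sqNorm, Finset.sum_add_distrib, hN]
    gcongr
    · exact le_rfl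
    · simpa using Finset.sum_le_card_nsmul Finset.univ _ s fun i _ => hs i
  rcases (by positivity : 0 ≤ N).eq_or_lt with hN0 | hN0
  · have hs0' : s = 0 := by nlinarith
    have hx : x = 0 := sqNorm_eq_zero.1 (by nlinarith)
    have hb : ∀ i, b i = 0 := fun i => sqNorm_eq_zero.1 <|
      (mul_eq_zero.1 (le_antisymm ((hs i).trans hs0'.le)
        (mul_nonneg v.coe_nonneg (sqNorm_nonneg _)))).resolve_left (by exact_mod_cast hv)
    simp [← hN0, hx, hb, sqNorm, Real.exp_nonneg]
  have htail := measureReal_le_sum_sq_le (s := N / Fintype.card ι) (N := N)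
    (hG.indep_affine_rows x b) (fun i => hG.hasLaw_affine_row (x i) (b i) i) (by positivity)
    (fun i => by
      rw [coe_mul_toNNReal_sqNorm, le_div_iff₀ hcard]
      linarith [mul_le_mul_of_nonneg_right (hs i) hcard.le]) hε0 hε1 hmean
  calc _ ≤ μ.real {ω | (1 + ε) * N ≤ sqNorm fun i => x i + G ω i ⬝ᵥ b i} :=
        measureReal_mono fun ω hω => by
          simp only [Set.mem_ofPred_eq] at hω ⊢
          nlinarith [mul_lt_mul_of_pos_left hω (by linarith : 0 < 1 + ε),
            mul_nonneg (sq_nonneg ε) (sqNorm_nonneg fun i => x i + G ω i ⬝ᵥ b i)]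
    _ ≤ _ := htail
    _ = _ := by
      congr 1
      field_simp

lemma measureReal_add_mulVec_lower_le (hG : IsGaussianMatrix μ G v)
    (hε0 : 0 ≤ ε) (hε1 : ε ≤ 1) (x : ι → ℝ) (b : κ → ℝ) :
    μ.real {ω | sqNorm (x + G ω *ᵥ b) <
        (1 - ε) * (sqNorm x + Fintype.card ι * (v * sqNorm b))} ≤
      Real.exp (-(ε ^ 2 * Fintype.card ι / 16)) := by
  have := hG.indep.isProbabilityMeasure
  have hw0 : 0 ≤ v * sqNorm b := mul_nonneg v.coe_nonneg (sqNorm_nonneg b)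
  have hx0 := sqNorm_nonneg x
  set N := sqNorm x + Fintype.card ι * (v * sqNorm b) with hN
  have hmean : ∑ i, (x i ^ 2 + ((v * (sqNorm b).toNNReal : NNReal) : ℝ)) = N := by
    rw [coe_mul_toNNReal_sqNorm, Finset.sum_add_distrib]
    simp [hN, sqNorm]
  rcases (by positivity : 0 ≤ N).eq_or_lt with hN0 | hN0
  · simp [← hN0, (sqNorm_nonneg _).not_gt, Real.exp_nonneg]
  have hcard : (0 : ℝ) < Fintype.card ι := by
    have : Nonempty ι := by
      by_contra hι
      have := not_nonempty_iff.1 hι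
      simp [hN, sqNorm] at hN0
    exact_mod_cast Fintype.card_pos
  have htail := measureReal_sum_sq_le_le (s := N / Fintype.card ι)
    (hG.indep_affine_rows x fun _ => b) (fun i => hG.hasLaw_affine_row (x i) b i)
    (by positivity) (fun _ => by
      rw [coe_mul_toNNReal_sqNorm, le_div_iff₀ hcard]
      linarith) hε0 hε1
  rw [hmean] at htail
  calc _ ≤ _ := measureReal_mono fun ω hω => (Set.mem_ofPred_eq ▸ hω).le
    _ ≤ _ := htail
    _ = _ := by
      congr 1
      field_simp

variable {x : Ω → ι → ℝ} {b : Ω → κ → ℝ}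

lemma measureReal_add_mulVec_upper_le_of_indepFun (hG : IsGaussianMatrix μ G v) (hv : v ≠ 0)
    (hε0 : 0 ≤ ε) (hε1 : ε ≤ 1) (hx : Measurable x) (hb : Measurable b)
    (h : IndepFun (fun ω => (x ω, b ω)) (fun ω i j => G ω i j) μ) :
    μ.real {ω | sqNorm (x ω) + Fintype.card ι * (v * sqNorm (b ω)) <
        (1 - ε) * sqNorm (x ω + G ω *ᵥ b ω)} ≤ Real.exp (-(ε ^ 2 * Fintype.card ι / 16)) := by
  have := hG.indep.isProbabilityMeasure
  have hGm := hG.measurable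
  refine measureReal_le_of_indepFun h (by fun_prop) (by fun_prop)
    (s := {p | sqNorm p.1.1 + Fintype.card ι * (v * sqNorm p.1.2) <
      (1 - ε) * sqNorm fun i => p.1.1 i + p.2 i ⬝ᵥ p.1.2})
    (measurableSet_lt (by fun_prop) (by unfold dotProduct; fun_prop))
    fun ω => hG.measureReal_affine_rows_upper_le hv hε0 hε1 (x ω) (fun _ => b ω) fun _ => le_rfl

lemma measureReal_add_mulVec_lower_le_of_indepFun (hG : IsGaussianMatrix μ G v)
    (hε0 : 0 ≤ ε) (hε1 : ε ≤ 1) (hx : Measurable x) (hb : Measurable b)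
    (h : IndepFun (fun ω => (x ω, b ω)) (fun ω i j => G ω i j) μ) :
    μ.real {ω | sqNorm (x ω + G ω *ᵥ b ω) <
        (1 - ε) * (sqNorm (x ω) + Fintype.card ι * (v * sqNorm (b ω)))} ≤
      Real.exp (-(ε ^ 2 * Fintype.card ι / 16)) := by
  have := hG.indep.isProbabilityMeasure
  have hGm := hG.measurable
  exact measureReal_le_of_indepFun h (by fun_prop) (by fun_prop)
    (s := {p | (sqNorm fun i => p.1.1 i + p.2 i ⬝ᵥ p.1.2) <
      (1 - ε) * (sqNorm p.1.1 + Fintype.card ι * (v * sqNorm p.1.2))})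
    (measurableSet_lt (by unfold dotProduct; fun_prop) (by fun_prop))
    fun ω => hG.measureReal_add_mulVec_lower_le hε0 hε1 (x ω) (b ω)

lemma measureReal_rows_upper_le_of_indepFun (hG : IsGaussianMatrix μ G v) (hv : v ≠ 0)
    (hε0 : 0 ≤ ε) (hε1 : ε ≤ 1) {b : Ω → ι → κ → ℝ} {s : ℝ} (hb : Measurable b)
    (hs : ∀ ω i, v * sqNorm (b ω i) ≤ s) (h : IndepFun b (fun ω i j => G ω i j) μ) :
    μ.real {ω | Fintype.card ι * s < (1 - ε) * sqNorm fun i => G ω i ⬝ᵥ b ω i} ≤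
      Real.exp (-(ε ^ 2 * Fintype.card ι / 16)) := by
  have := hG.indep.isProbabilityMeasure
  have hGm := hG.measurable
  exact measureReal_le_of_indepFun h hb (by fun_prop)
    (s := {p | Fintype.card ι * s < (1 - ε) * sqNorm fun i => p.2 i ⬝ᵥ p.1 i})
    (measurableSet_lt (by fun_prop) (by unfold dotProduct; fun_prop))
    fun ω => by simpa [sqNorm] using
      hG.measureReal_affine_rows_upper_le hv hε0 hε1 0 (b ω) (hs ω)

end IsGaussianMatrix

section Deterministic

variable {d n : ℕ} {R : ℝ}

lemma colNormSq_nonneg (A : Matrix (Fin d) (Fin n) ℝ) (t : Fin n) : 0 ≤ colNormSq A t :=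
  Finset.sum_nonneg fun _ _ => sq_nonneg _

lemma frobSq_nonneg (A : Matrix (Fin d) (Fin n) ℝ) : 0 ≤ frobSq A :=
  Finset.sum_nonneg fun _ _ => Finset.sum_nonneg fun _ _ => sq_nonneg _

lemma stableRank_nonneg (A : Matrix (Fin d) (Fin n) ℝ) : 0 ≤ stableRank A :=
  div_nonneg (frobSq_nonneg A) (sq_nonneg _)

lemma frobSq_le_of_colNormSq_le {A : Matrix (Fin d) (Fin n) ℝ} (hR : ∀ t, colNormSq A t ≤ R) :
    frobSq A ≤ n * R := by
  calc frobSq A = ∑ t, colNormSq A t := Finset.sum_comm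
    _ ≤ n * R := by
      simpa using Finset.sum_le_card_nsmul Finset.univ (colNormSq A) R fun t _ => hR t

lemma sqNorm_mulVec_le (A : Matrix (Fin d) (Fin n) ℝ) (u : Fin n → ℝ) :
    sqNorm (A *ᵥ u) ≤ opNorm A ^ 2 * sqNorm u := by
  have h := pow_le_pow_left₀ (norm_nonneg _)
    ((Matrix.toEuclideanLin A).toContinuousLinearMap.le_opNorm (WithLp.toLp 2 u)) 2
  rw [mul_pow, EuclideanSpace.norm_sq_eq, EuclideanSpace.norm_sq_eq] at h
  simpa [opNorm, sqNorm] using h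

lemma stableRank_mul_sq_opNorm_le (A : Matrix (Fin d) (Fin n) ℝ) :
    stableRank A * opNorm A ^ 2 ≤ frobSq A := by
  rw [stableRank, div_mul_eq_mul_div, mul_div_assoc]
  exact mul_le_of_le_one_right (frobSq_nonneg A) (div_self_le_one _)

lemma stableRank_mul_sqNorm_mulVec_le (A : Matrix (Fin d) (Fin n) ℝ) (u : Fin n → ℝ) :
    stableRank A * sqNorm (A *ᵥ u) ≤ frobSq A * sqNorm u := by
  calc stableRank A * sqNorm (A *ᵥ u) ≤ stableRank A * (opNorm A ^ 2 * sqNorm u) :=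
        mul_le_mul_of_nonneg_left (sqNorm_mulVec_le A u) (stableRank_nonneg A)
    _ = stableRank A * opNorm A ^ 2 * sqNorm u := (mul_assoc _ _ _).symm
    _ ≤ frobSq A * sqNorm u :=
        mul_le_mul_of_nonneg_right (stableRank_mul_sq_opNorm_le A) (sqNorm_nonneg u)

lemma stableRank_mul_sqNorm_mulVec_le_of_colNormSq_le {X : Matrix (Fin d) (Fin n) ℝ}
    (hR : ∀ t, colNormSq X t ≤ R) (u : Fin n → ℝ) :
    stableRank X * sqNorm (X *ᵥ u) ≤ n * R * sqNorm u :=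
  (stableRank_mul_sqNorm_mulVec_le X u).trans
    (mul_le_mul_of_nonneg_right (frobSq_le_of_colNormSq_le hR) (sqNorm_nonneg u))

lemma colNormSq_rmsNorm_le (X : Matrix (Fin d) (Fin n) ℝ) (t : Fin n) :
    colNormSq (rmsNorm X) t ≤ d := by
  have h0 := colNormSq_nonneg X t
  have h : colNormSq (rmsNorm X) t = d * (colNormSq X t / colNormSq X t) := by
    unfold colNormSq at h0
    simp only [colNormSq, rmsNorm, mul_pow, div_pow]
    rw [Real.sq_sqrt (Nat.cast_nonneg d), Real.sq_sqrt h0, ← Finset.mul_sum, ← Finset.sum_div]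
  rw [h]
  exact mul_le_of_le_one_right (Nat.cast_nonneg d) (div_self_le_one _)

lemma rmsNorm_mul_sqrt_colNormSq (X : Matrix (Fin d) (Fin n) ℝ) (i : Fin d) (t : Fin n) :
    rmsNorm X i t * √(colNormSq X t) = √d * X i t := by
  rcases (colNormSq_nonneg X t).eq_or_lt' with h0 | h0
  · have hzero : X i t = 0 := congrFun (sqNorm_eq_zero.1 h0 : (fun i => X i t) = 0) i
    simp [rmsNorm, hzero]
  · rw [rmsNorm, mul_assoc, div_mul_cancel₀ _ (Real.sqrt_pos.2 h0).ne']

lemma sqNorm_rmsNorm_mulVec (X : Matrix (Fin d) (Fin n) ℝ) (u : Fin n → ℝ) :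
    sqNorm (rmsNorm X *ᵥ fun t => √(colNormSq X t) * u t) = d * sqNorm (X *ᵥ u) := by
  simp only [sqNorm, Matrix.mulVec, dotProduct, ← mul_assoc, rmsNorm_mul_sqrt_colNormSq]
  simp only [mul_assoc, ← Finset.mul_sum, mul_pow, Real.sq_sqrt (Nat.cast_nonneg d)]

lemma stableRank_rmsNorm_mul_sqNorm_mulVec_le (hd : 0 < d) {X : Matrix (Fin d) (Fin n) ℝ}
    (hR : ∀ t, colNormSq X t ≤ R) (u : Fin n → ℝ) :
    stableRank (rmsNorm X) * sqNorm (X *ᵥ u) ≤ n * R * sqNorm u := by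
  have hweighted : (sqNorm fun t => √(colNormSq X t) * u t) ≤ R * sqNorm u := by
    rw [sqNorm, sqNorm, Finset.mul_sum]
    refine Finset.sum_le_sum fun t _ => ?_
    rw [mul_pow, Real.sq_sqrt (colNormSq_nonneg X t)]
    exact mul_le_mul_of_nonneg_right (hR t) (sq_nonneg _)
  have h := stableRank_mul_sqNorm_mulVec_le_of_colNormSq_le (colNormSq_rmsNorm_le X)
    fun t => √(colNormSq X t) * u t
  rw [sqNorm_rmsNorm_mulVec] at h
  have hd' : (0 : ℝ) < d := by exact_mod_cast hd
  refine le_of_mul_le_mul_left ?_ hd'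
  calc d * (stableRank (rmsNorm X) * sqNorm (X *ᵥ u))
      ≤ n * d * sqNorm fun t => √(colNormSq X t) * u t := by linarith
    _ ≤ n * d * (R * sqNorm u) := by gcongr
    _ = d * (n * R * sqNorm u) := by ring

lemma colNormSq_mul_le_of_stdSimplex {k : ℕ} {A : Matrix (Fin d) (Fin k) ℝ}
    (hR : ∀ s, colNormSq A s ≤ R) {P : Matrix (Fin k) (Fin n) ℝ} {t : Fin n}
    (hP : (fun s => P s t) ∈ stdSimplex ℝ (Fin k)) : colNormSq (A * P) t ≤ R := by
  obtain ⟨h0, h1⟩ := hP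
  calc colNormSq (A * P) t ≤ ∑ j, ∑ s, P s t * A j s ^ 2 := by
        refine Finset.sum_le_sum fun j _ => ?_
        have hconvex := (even_two.convexOn_pow (𝕜 := ℝ)).map_sum_le (t := Finset.univ)
          (w := fun s => P s t) (p := fun s => A j s) (fun s _ => h0 s) h1
          fun _ _ => Set.mem_univ _
        simpa [Matrix.mul_apply, mul_comm] using hconvex
    _ = ∑ s, P s t * colNormSq A s := by
        rw [Finset.sum_comm]
        simp only [colNormSq, Finset.mul_sum]
    _ ≤ ∑ s, P s t * R := by
        gcongr with s
        exacts [h0 s, hR s]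
    _ = R := by rw [← Finset.sum_mul, h1, one_mul]

end Deterministic

section Tokens

variable {n V : ℕ}

/-- The matrix whose `t`-th column is the basis vector of the `t`-th token, so that
`X⁽⁰⁾ = E * oneHot tok`. -/
def oneHot (tok : Fin n → Fin V) : Matrix (Fin V) (Fin n) ℝ :=
  fun j t => if tok t = j then 1 else 0

lemma colNormSq_oneHot (tok : Fin n → Fin V) (t : Fin n) : colNormSq (oneHot tok) t = 1 := by
  simp [colNormSq, oneHot]

lemma sqNorm_oneHot_row (tok : Fin n → Fin V) (j : Fin V) :
    sqNorm (oneHot tok j) = (Finset.univ.filter fun t => tok t = j).card := by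
  simp [sqNorm, oneHot]

lemma sq_sqNorm_oneHot_row_le (tok : Fin n → Fin V) (j : Fin V) :
    sqNorm (oneHot tok j) ^ 2 ≤ sqNorm (oneHot tok *ᵥ oneHot tok j) := by
  have hentry : (oneHot tok *ᵥ oneHot tok j) j = sqNorm (oneHot tok j) := by
    simp [Matrix.mulVec, dotProduct, sqNorm, sq]
  rw [← hentry]
  exact Finset.single_le_sum (f := fun i => (oneHot tok *ᵥ oneHot tok j) i ^ 2)
    (fun _ _ => sq_nonneg _) (Finset.mem_univ j)

lemma exists_sqNorm_oneHot_row_eq (hn : 0 < n) (tok : Fin n → Fin V) :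
    ∃ j, sqNorm (oneHot tok j) = n * pMax tok := by
  have hn' : (0 : ℝ) < n := by exact_mod_cast hn
  have : Nonempty (Fin V) := ⟨tok ⟨0, hn⟩⟩
  obtain ⟨j, hj⟩ := exists_eq_ciSup_of_finite
    (f := fun j : Fin V => ((Finset.univ.filter fun t => tok t = j).card : ℝ) / n)
  refine ⟨j, ?_⟩
  rw [sqNorm_oneHot_row, pMax, ← hj, mul_div_cancel₀ _ hn'.ne']

lemma pMax_pos (hn : 0 < n) (tok : Fin n → Fin V) : 0 < pMax tok := by
  have hcard : 0 < (Finset.univ.filter fun t => tok t = tok ⟨0, hn⟩).card :=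
    Finset.card_pos.2 ⟨⟨0, hn⟩, by simp⟩
  exact (div_pos (Nat.cast_pos.2 hcard) (Nat.cast_pos.2 hn)).trans_le (le_ciSup
    (Finite.bddAbove_range fun j : Fin V =>
      ((Finset.univ.filter fun t => tok t = j).card : ℝ) / n) (tok ⟨0, hn⟩))

end Tokens

section NormControl

variable {d k n : ℕ} {a c p q w R Q : ℝ} {u : Fin n → ℝ} {X Y : Matrix (Fin d) (Fin n) ℝ}
  {H : Matrix (Fin k) (Fin n) ℝ}

/-- Up to the factor `q`, the squared column norms of `X` are at most `R` and the squared norm of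
`X u` is at least `Q`. These two bounds propagate through the layers, and together they bound the
stable rank of `X` and of its normalization. -/
structure NormControl (q R Q : ℝ) (u : Fin n → ℝ) (X : Matrix (Fin d) (Fin n) ℝ) : Prop where
  colNormSq_le : ∀ t, q * colNormSq X t ≤ R
  le_sqNorm_mulVec : q * Q ≤ sqNorm (X *ᵥ u)

/-- `Y` has, up to the factor `q`, the squared norms of a sum of `X` and of `√w` times an isometric
image of `H` orthogonal to `X`: an upper bound for the columns, a lower bound in the direction `u`.
This is the typical behaviour of `Y = X + G * H` for an independent Gaussian matrix `G` with
columns of mean squared norm `w`. -/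
structure IsTypicalUpdate (q w : ℝ) (u : Fin n → ℝ) (X : Matrix (Fin d) (Fin n) ℝ)
    (H : Matrix (Fin k) (Fin n) ℝ) (Y : Matrix (Fin d) (Fin n) ℝ) : Prop where
  colNormSq_le : ∀ t, q * colNormSq Y t ≤ colNormSq X t + w * colNormSq H t
  le_sqNorm_mulVec : q * (sqNorm (X *ᵥ u) + w * sqNorm (H *ᵥ u)) ≤ sqNorm (Y *ᵥ u)

lemma IsTypicalUpdate.normControl_oneHot {V : ℕ} {tok : Fin n → Fin V} {j : Fin V} (hq : 0 ≤ q)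
    (hw : 0 ≤ w) (h : IsTypicalUpdate q w (oneHot tok j) 0 (oneHot tok) Y) :
    NormControl q w (w * sqNorm (oneHot tok j) ^ 2) (oneHot tok j) Y where
  colNormSq_le t := by
    have h := h.colNormSq_le t
    rw [colNormSq_oneHot] at h
    simpa [colNormSq] using h
  le_sqNorm_mulVec := by
    refine le_trans ?_ h.le_sqNorm_mulVec
    have := sqNorm_nonneg ((0 : Matrix (Fin d) (Fin n) ℝ) *ᵥ oneHot tok j)
    have := mul_le_mul_of_nonneg_left (sq_sqNorm_oneHot_row_le tok j) hw
    exact mul_le_mul_of_nonneg_left (by linarith) hq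

namespace NormControl

lemma update (hX : NormControl p R Q u X) (hY : IsTypicalUpdate q w u X H Y) (hp0 : 0 ≤ p)
    (hp1 : p ≤ 1) (ha0 : 0 ≤ a) (ha1 : a ≤ 1) (hq : 0 ≤ q) (hw : 0 ≤ w)
    (hc : ∀ t, a * (w * colNormSq H t) ≤ c) : NormControl (p * (a * q)) (R + c) Q u Y where
  colNormSq_le t := by
    calc p * (a * q) * colNormSq Y t = p * a * (q * colNormSq Y t) := by ring
      _ ≤ p * a * (colNormSq X t + w * colNormSq H t) := by gcongr; exact hY.colNormSq_le t
      _ = a * (p * colNormSq X t) + p * (a * (w * colNormSq H t)) := by ring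
      _ ≤ 1 * (p * colNormSq X t) + 1 * c := by
        have := mul_nonneg hp0 (colNormSq_nonneg X t)
        exact add_le_add (mul_le_mul_of_nonneg_right ha1 this)
          (mul_le_mul hp1 (hc t) (by have := colNormSq_nonneg H t; positivity) zero_le_one)
      _ ≤ R + c := by linarith [hX.colNormSq_le t]
  le_sqNorm_mulVec := by
    have hHu := mul_nonneg hw (sqNorm_nonneg (H *ᵥ u))
    calc p * (a * q) * Q = a * (q * (p * Q)) := by ring
      _ ≤ a * (q * sqNorm (X *ᵥ u)) := by gcongr; exact hX.le_sqNorm_mulVec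
      _ ≤ 1 * (q * sqNorm (X *ᵥ u)) := by
        have := mul_nonneg hq (sqNorm_nonneg (X *ᵥ u))
        gcongr
      _ ≤ q * (sqNorm (X *ᵥ u) + w * sqNorm (H *ᵥ u)) := by
        rw [one_mul]
        gcongr
        linarith
      _ ≤ sqNorm (Y *ᵥ u) := hY.le_sqNorm_mulVec

lemma le_of_mul_sqNorm_mulVec_le {y : ℝ} (hX : NormControl q R Q u X) (hq : 0 < q) (hQ : 0 < Q)
    (hy0 : 0 ≤ y) (hy : y * sqNorm (X *ᵥ u) ≤ n * (R / q) * sqNorm u) :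
    y ≤ n * R * sqNorm u / (q ^ 2 * Q) := by
  rw [le_div_iff₀ (by positivity)]
  calc y * (q ^ 2 * Q) = q * (y * (q * Q)) := by ring
    _ ≤ q * (n * (R / q) * sqNorm u) := mul_le_mul_of_nonneg_left
      ((mul_le_mul_of_nonneg_left hX.le_sqNorm_mulVec hy0).trans hy) hq.le
    _ = n * R * sqNorm u := by field_simp

lemma colNormSq_le_div (hX : NormControl q R Q u X) (hq : 0 < q) (t : Fin n) :
    colNormSq X t ≤ R / q := by
  rw [le_div_iff₀' hq]
  exact hX.colNormSq_le t

lemma stableRank_le (hX : NormControl q R Q u X) (hq : 0 < q) (hQ : 0 < Q) :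
    stableRank X ≤ n * R * sqNorm u / (q ^ 2 * Q) :=
  hX.le_of_mul_sqNorm_mulVec_le hq hQ (stableRank_nonneg X)
    (stableRank_mul_sqNorm_mulVec_le_of_colNormSq_le (hX.colNormSq_le_div hq) u)

lemma stableRank_rmsNorm_le (hX : NormControl q R Q u X) (hq : 0 < q) (hQ : 0 < Q) (hd : 0 < d) :
    stableRank (rmsNorm X) ≤ n * R * sqNorm u / (q ^ 2 * Q) :=
  hX.le_of_mul_sqNorm_mulVec_le hq hQ (stableRank_nonneg _)
    (stableRank_rmsNorm_mul_sqNorm_mulVec_le hd (hX.colNormSq_le_div hq) u)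

end NormControl

end NormControl

section Measurability

variable {Ω : Type*} [MeasurableSpace Ω] {d n k : ℕ}

lemma measurable_colNormSq {A : Ω → Matrix (Fin d) (Fin n) ℝ}
    (hA : ∀ i t, Measurable fun ω => A ω i t) (t : Fin n) :
    Measurable fun ω => colNormSq (A ω) t := by
  unfold colNormSq
  fun_prop

lemma measurable_opNorm {A : Ω → Matrix (Fin d) (Fin n) ℝ}
    (hA : ∀ i t, Measurable fun ω => A ω i t) : Measurable fun ω => opNorm (A ω) := by
  let f : (Fin d → Fin n → ℝ) →ₗ[ℝ] (EuclideanSpace ℝ (Fin n) →L[ℝ] EuclideanSpace ℝ (Fin d)) :=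
    (LinearMap.toContinuousLinearMap.toLinearMap ∘ₗ
      (Matrix.toEuclideanLin (𝕜 := ℝ) (m := Fin d) (n := Fin n)).toLinearMap) ∘ₗ
      (Matrix.ofLinearEquiv ℝ).toLinearMap
  have hf : Continuous fun B : Fin d → Fin n → ℝ => ‖f B‖ :=
    (LinearMap.continuous_of_finiteDimensional f).norm
  exact hf.measurable.comp (measurable_pi_iff.2 fun i => measurable_pi_iff.2 fun t => hA i t)

lemma measurable_stableRank {A : Ω → Matrix (Fin d) (Fin n) ℝ}
    (hA : ∀ i t, Measurable fun ω => A ω i t) : Measurable fun ω => stableRank (A ω) := by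
  have := measurable_opNorm hA
  unfold stableRank frobSq
  fun_prop

lemma measurable_rmsNorm {A : Ω → Matrix (Fin d) (Fin n) ℝ}
    (hA : ∀ i t, Measurable fun ω => A ω i t) (i : Fin d) (t : Fin n) :
    Measurable fun ω => rmsNorm (A ω) i t := by
  have := measurable_colNormSq hA t
  unfold rmsNorm
  fun_prop

lemma measurable_matrix_mul {A : Ω → Matrix (Fin d) (Fin k) ℝ} {B : Ω → Matrix (Fin k) (Fin n) ℝ}
    (hA : ∀ i t, Measurable fun ω => A ω i t) (hB : ∀ i t, Measurable fun ω => B ω i t)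
    (i : Fin d) (t : Fin n) : Measurable fun ω => (A ω * B ω) i t := by
  simp only [Matrix.mul_apply]
  fun_prop

lemma measurable_rmsNorm_mul {ι : Type*} (h : ι) (i : Fin d) (t : Fin n) :
    Measurable fun p : (Fin d → Fin k → ℝ) × (ι → Fin k → Fin n → ℝ) =>
      (rmsNorm (Matrix.of p.1) * Matrix.of (p.2 h)) i t :=
  measurable_matrix_mul (measurable_rmsNorm fun i t => by simp only [Matrix.of_apply]; fun_prop)
    (fun i t => by simp only [Matrix.of_apply]; fun_prop) i t

end Measurability

section UnionBound

variable {Ω : Type*} [MeasurableSpace Ω] {μ : Measure Ω}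

lemma measureReal_not_and_le [IsFiniteMeasure μ] (p q : Ω → Prop) :
    μ.real {ω | ¬ (p ω ∧ q ω)} ≤ μ.real {ω | ¬ p ω} + μ.real {ω | ¬ q ω} :=
  (measureReal_mono fun _ => not_and_or.1).trans (measureReal_union_le _ _)

lemma measureReal_not_forall_le [IsFiniteMeasure μ] {ι : Type*} [Fintype ι] {p : ι → Ω → Prop}
    {δ : ℝ} (h : ∀ i, μ.real {ω | ¬ p i ω} ≤ δ) :
    μ.real {ω | ¬ ∀ i, p i ω} ≤ Fintype.card ι * δ := by
  calc μ.real {ω | ¬ ∀ i, p i ω} ≤ μ.real (⋃ i, {ω | ¬ p i ω}) :=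
        measureReal_mono fun _ hω => Set.mem_iUnion.2 (not_forall.1 hω)
    _ ≤ ∑ i, μ.real {ω | ¬ p i ω} := measureReal_iUnion_fintype_le _
    _ ≤ ∑ _i : ι, δ := Finset.sum_le_sum fun i _ => h i
    _ = Fintype.card ι * δ := by simp

lemma one_sub_measureReal_not_le [IsProbabilityMeasure μ] {p q : Ω → Prop}
    (hpq : ∀ ω, p ω → q ω) : 1 - μ.real {ω | ¬ p ω} ≤ μ.real {ω | q ω} := by
  rw [sub_le_iff_le_add, ← probReal_univ (μ := μ)]
  refine (measureReal_mono fun ω _ => ?_).trans (measureReal_union_le _ _)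
  exact or_iff_not_imp_right.2 fun hω => hpq ω (not_not.1 hω)

end UnionBound

section TypicalUpdate

variable {Ω : Type*} [MeasurableSpace Ω] {μ : Measure Ω} {d k n : ℕ} {v : NNReal} {ε : ℝ}
  {G : Ω → Matrix (Fin d) (Fin k) ℝ} {X : Ω → Matrix (Fin d) (Fin n) ℝ}
  {H : Ω → Matrix (Fin k) (Fin n) ℝ}

lemma IsGaussianMatrix.measureReal_not_isTypicalUpdate_le (hG : IsGaussianMatrix μ G v)
    (hv : v ≠ 0) (hε0 : 0 ≤ ε) (hε1 : ε ≤ 1) (hX : ∀ i t, Measurable fun ω => X ω i t)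
    (hH : ∀ i t, Measurable fun ω => H ω i t)
    (h : IndepFun (fun ω => ((fun i t => X ω i t, fun i t => H ω i t) :
      (Fin d → Fin n → ℝ) × (Fin k → Fin n → ℝ))) (fun ω i j => G ω i j) μ) (u : Fin n → ℝ) :
    μ.real {ω | ¬ IsTypicalUpdate (1 - ε) (d * v) u (X ω) (H ω) (X ω + G ω * H ω)} ≤
      (n + 1) * Real.exp (-(ε ^ 2 * d / 16)) := by
  have := hG.indep.isProbabilityMeasure
  have hcol : ∀ t, μ.real {ω | ¬ (1 - ε) * colNormSq (X ω + G ω * H ω) t ≤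
      colNormSq (X ω) t + d * v * colNormSq (H ω) t} ≤ Real.exp (-(ε ^ 2 * d / 16)) := fun t => by
    have hupper := hG.measureReal_add_mulVec_upper_le_of_indepFun hv hε0 hε1
      (x := fun ω i => X ω i t) (b := fun ω i => H ω i t) (by fun_prop) (by fun_prop)
      (h.comp (φ := fun p => (fun i => p.1 i t, fun i => p.2 i t)) (by fun_prop) measurable_id)
    simp only [Fintype.card_fin, ← mul_assoc, ← not_le] at hupper
    exact hupper
  have hdir : μ.real {ω | ¬ (1 - ε) * (sqNorm (X ω *ᵥ u) + d * v * sqNorm (H ω *ᵥ u)) ≤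
      sqNorm ((X ω + G ω * H ω) *ᵥ u)} ≤ Real.exp (-(ε ^ 2 * d / 16)) := by
    have hlower := hG.measureReal_add_mulVec_lower_le_of_indepFun hε0 hε1
      (x := fun ω => X ω *ᵥ u) (b := fun ω => H ω *ᵥ u)
      (by unfold Matrix.mulVec dotProduct; fun_prop) (by unfold Matrix.mulVec dotProduct; fun_prop)
      (h.comp (φ := fun p => (Matrix.of p.1 *ᵥ u, Matrix.of p.2 *ᵥ u))
        (by unfold Matrix.mulVec dotProduct; fun_prop) measurable_id)
    simpa only [Fintype.card_fin, ← mul_assoc, not_le, Matrix.add_mulVec,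
      Matrix.mulVec_mulVec] using hlower
  have hunion := (measureReal_not_and_le _ _).trans
    (add_le_add (measureReal_not_forall_le hcol) hdir)
  rw [Fintype.card_fin, ← add_one_mul] at hunion
  exact (measureReal_mono fun _ => mt fun hgood => ⟨hgood.1, hgood.2⟩).trans hunion

end TypicalUpdate

lemma indepFun_pi_of_disjoint_range {Ω ι α β γ : Type*} [MeasurableSpace Ω] [MeasurableSpace γ]
    {μ : Measure Ω} [Finite α] [Finite β] {f : ι → Ω → γ} (hf : iIndepFun f μ)
    (hm : ∀ i, Measurable (f i)) {g₁ : α → ι} {g₂ : β → ι}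
    (hg : Disjoint (Set.range g₁) (Set.range g₂)) :
    IndepFun (fun ω a => f (g₁ a) ω) (fun ω b => f (g₂ b) ω) μ := by
  classical
  have := Fintype.ofFinite α
  have := Fintype.ofFinite β
  have h := hf.indepFun_finset (Finset.univ.image g₁) (Finset.univ.image g₂)
    (by simpa [← Finset.disjoint_coe] using hg) hm
  exact h.comp (φ := fun x a => x ⟨g₁ a, Finset.mem_image_of_mem _ (Finset.mem_univ a)⟩)
    (ψ := fun x b => x ⟨g₂ b, Finset.mem_image_of_mem _ (Finset.mem_univ b)⟩)
    (by fun_prop) (by fun_prop)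

/-- The head a row of the stacked matrix `concatHeads` belongs to, and its index in that head. -/
def headRow {d nHead : ℕ} (hdvd : nHead ∣ d) : Fin d ≃ Fin nHead × Fin (d / nHead) :=
  (finCongr (Nat.mul_div_cancel' hdvd).symm).trans finProdFinEquiv.symm

namespace Transformer

variable {Ω : Type*} {V d nHead k n : ℕ} (T : Transformer Ω V d nHead k n)

/-- The attention averages `RMSNorm(X⁽ˡ⁾) · P⁽ʰ⁾` of one head. -/
def mixed (ℓ : ℕ) (h : Fin nHead) (ω : Ω) : Matrix (Fin d) (Fin n) ℝ :=
  rmsNorm (T.hidden ℓ ω) * T.P ℓ h ω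

/-- The value projections of all heads of a layer, stacked vertically. -/
def stackedWV (ℓ : ℕ) (ω : Ω) : Matrix (Fin d) (Fin d) ℝ :=
  fun i => T.WV ℓ (headRow T.head_dvd i).1 ω (headRow T.head_dvd i).2

/-- The concatenated head outputs `H⁽ˡ⁾`. -/
def headOut (ℓ : ℕ) (ω : Ω) : Matrix (Fin d) (Fin n) ℝ :=
  concatHeads T.head_dvd fun h => T.WV ℓ h ω * T.mixed ℓ h ω

lemma hidden_zero_eq (ω : Ω) : T.hidden 0 ω = 0 + T.E ω * oneHot T.tok := by
  ext i t
  simp [hidden, embedded, oneHot, Matrix.mul_apply]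

lemma hiddenAtt_eq (ℓ : ℕ) (ω : Ω) :
    T.hiddenAtt ℓ ω = T.hidden ℓ ω + T.WO ℓ ω * T.headOut ℓ ω :=
  rfl

lemma hidden_succ_eq (ℓ : ℕ) (ω : Ω) :
    T.hidden (ℓ + 1) ω = T.hiddenAtt ℓ ω + T.W2 ℓ ω * T.B ℓ ω :=
  rfl

namespace GaussianInit

variable {T} [MeasurableSpace Ω] {μ : Measure Ω} {L ℓ : ℕ}

lemma isGaussianMatrix {ι κ : Type*} {v : NNReal} (hT : T.GaussianInit μ L)
    {g : ι → κ → WeightIdx L V d nHead k} (hg : Function.Injective2 g)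
    (hv : ∀ i j, weightVar (g i j) = v) :
    IsGaussianMatrix μ (fun ω i j => T.weight (g i j) ω) v where
  measurable i j := hT.measurable_weight (g i j)
  indep := hT.indep.precomp hg.uncurry
  law i j := hv i j ▸ hT.law (g i j)

lemma isGaussianMatrix_E (hT : T.GaussianInit μ L) : IsGaussianMatrix μ T.E 1 :=
  hT.isGaussianMatrix (g := .embed) (fun _ _ _ _ h => by simpa using h) fun _ _ => rfl

lemma isGaussianMatrix_WO (hT : T.GaussianInit μ L) (hℓ : ℓ < L) :
    IsGaussianMatrix μ (T.WO ℓ) (d : NNReal)⁻¹ :=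
  hT.isGaussianMatrix (g := .out ⟨ℓ, hℓ⟩) (fun _ _ _ _ h => by simpa using h) fun _ _ => rfl

lemma isGaussianMatrix_W2 (hT : T.GaussianInit μ L) (hℓ : ℓ < L) :
    IsGaussianMatrix μ (T.W2 ℓ) (k : NNReal)⁻¹ :=
  hT.isGaussianMatrix (g := .mlp ⟨ℓ, hℓ⟩) (fun _ _ _ _ h => by simpa using h) fun _ _ => rfl

lemma isGaussianMatrix_stackedWV (hT : T.GaussianInit μ L) (hℓ : ℓ < L) :
    IsGaussianMatrix μ (T.stackedWV ℓ) (d : NNReal)⁻¹ :=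
  hT.isGaussianMatrix
    (g := fun i j => .value ⟨ℓ, hℓ⟩ (headRow T.head_dvd i).1 (headRow T.head_dvd i).2 j)
    (fun _ _ _ _ h => by simpa [← and_assoc, ← Prod.ext_iff] using h) fun _ _ => rfl

lemma measurable_WV (hT : T.GaussianInit μ L) (hℓ : ℓ < L) (h : Fin nHead)
    (i : Fin (d / nHead)) (j : Fin d) : Measurable fun ω => T.WV ℓ h ω i j :=
  hT.measurable_weight (.value ⟨ℓ, hℓ⟩ h i j)

lemma measurable_mixed (hT : T.GaussianInit μ L) (hℓ : ℓ < L)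
    (hX : ∀ i t, Measurable fun ω => T.hidden ℓ ω i t) (h : Fin nHead) (j : Fin d) (t : Fin n) :
    Measurable fun ω => T.mixed ℓ h ω j t :=
  measurable_matrix_mul (measurable_rmsNorm hX) (hT.measurable_P ℓ hℓ h) j t

lemma measurable_headOut (hT : T.GaussianInit μ L) (hℓ : ℓ < L)
    (hX : ∀ i t, Measurable fun ω => T.hidden ℓ ω i t) (i : Fin d) (t : Fin n) :
    Measurable fun ω => T.headOut ℓ ω i t :=
  measurable_matrix_mul (hT.measurable_WV hℓ _) (hT.measurable_mixed hℓ hX _) _ t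

lemma measurable_hiddenAtt_of_hidden (hT : T.GaussianInit μ L) (hℓ : ℓ < L)
    (hX : ∀ i t, Measurable fun ω => T.hidden ℓ ω i t) (i : Fin d) (t : Fin n) :
    Measurable fun ω => T.hiddenAtt ℓ ω i t :=
  (hX i t).add (measurable_matrix_mul (hT.isGaussianMatrix_WO hℓ).measurable
    (hT.measurable_headOut hℓ hX) i t)

lemma measurable_hidden (hT : T.GaussianInit μ L) (hℓ : ℓ ≤ L) (i : Fin d) (t : Fin n) :
    Measurable fun ω => T.hidden ℓ ω i t := by
  induction ℓ generalizing i t with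
  | zero => exact hT.isGaussianMatrix_E.measurable i (T.tok t)
  | succ ℓ ih =>
    exact (hT.measurable_hiddenAtt_of_hidden hℓ (ih (Nat.le_of_succ_le hℓ)) i t).add
      (measurable_matrix_mul (hT.isGaussianMatrix_W2 hℓ).measurable (hT.measurable_B ℓ hℓ) i t)

lemma measurable_hiddenAtt (hT : T.GaussianInit μ L) (hℓ : ℓ < L) (i : Fin d) (t : Fin n) :
    Measurable fun ω => T.hiddenAtt ℓ ω i t :=
  hT.measurable_hiddenAtt_of_hidden hℓ (hT.measurable_hidden hℓ.le) i t

lemma indepFun_WV_WO (hT : T.GaussianInit μ L) (hℓ : ℓ < L) :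
    IndepFun (fun ω h i j => T.WV ℓ h ω i j) (fun ω i j => T.WO ℓ ω i j) μ := by
  have h := indepFun_pi_of_disjoint_range hT.indep hT.measurable_weight
    (g₁ := fun p : Fin nHead × Fin (d / nHead) × Fin d => .value ⟨ℓ, hℓ⟩ p.1 p.2.1 p.2.2)
    (g₂ := fun p : Fin d × Fin d => .out ⟨ℓ, hℓ⟩ p.1 p.2)
    (Set.disjoint_left.2 (by rintro _ ⟨_, rfl⟩ ⟨_, h⟩; cases h))
  exact h.comp (φ := fun x h i j => x (h, i, j)) (ψ := fun x i j => x (i, j))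
    (by fun_prop) (by fun_prop)

lemma indepFun_mixed_stackedWV (hT : T.GaussianInit μ L) (hℓ : ℓ < L) (t : Fin n) :
    IndepFun (fun ω i j => T.mixed ℓ (headRow T.head_dvd i).1 ω j t)
      (fun ω i j => T.stackedWV ℓ ω i j) μ := by
  exact (hT.indep_P ℓ hℓ).comp
    (φ := fun p i j =>
      (rmsNorm (Matrix.of p.1) * Matrix.of (p.2 (headRow T.head_dvd i).1)) j t)
    (ψ := fun p i j => p.1 (headRow T.head_dvd i).1 (headRow T.head_dvd i).2 j)
    (measurable_pi_iff.2 fun _ => measurable_pi_iff.2 fun j =>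
      measurable_rmsNorm_mul _ j t) (by fun_prop)

lemma indepFun_hidden_headOut_WO (hT : T.GaussianInit μ L) (hℓ : ℓ < L) :
    IndepFun (fun ω => ((fun i t => T.hidden ℓ ω i t, fun i t => T.headOut ℓ ω i t) :
        (Fin d → Fin n → ℝ) × (Fin d → Fin n → ℝ)))
      (fun ω i j => T.WO ℓ ω i j) μ := by
  have := hT.indep.isProbabilityMeasure
  have hX := hT.measurable_hidden hℓ.le
  have hP := hT.measurable_P ℓ hℓ
  have hV := hT.measurable_WV hℓ
  have hO := (hT.isGaussianMatrix_WO hℓ).measurable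
  have hweights := (hT.indep_P ℓ hℓ).comp (φ := id) (ψ := fun p => (p.1, p.2.1)) measurable_id
    (by fun_prop)
  have hWO := indepFun_prodMk_left_of_prodMk_right hweights (hT.indepFun_WV_WO hℓ) (by fun_prop)
    (by fun_prop) (by fun_prop)
  refine hWO.comp (φ := fun p : ((Fin d → Fin n → ℝ) × (Fin nHead → Fin n → Fin n → ℝ)) ×
      (Fin nHead → Fin (d / nHead) → Fin d → ℝ) => (p.1.1, fun i t =>
        ∑ j, p.2 (headRow T.head_dvd i).1 (headRow T.head_dvd i).2 j *
          (rmsNorm (Matrix.of p.1.1) * Matrix.of (p.1.2 (headRow T.head_dvd i).1)) j t))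
    (Measurable.prodMk (by fun_prop) (measurable_pi_iff.2 fun i => measurable_pi_iff.2 fun t => ?_))
    measurable_id
  exact Finset.measurable_sum _ fun j _ => Measurable.mul (by fun_prop)
    ((measurable_rmsNorm_mul _ j t).comp measurable_fst)

end GaussianInit

/-- The behaviour of the embedding and of the first `L` layers under which the stable ranks stay
controlled: every Gaussian product has its typical size up to the factor `q`, and the conclusions
of the propagation interface hold. -/
structure IsTypical (q Cprop m : ℝ) (u : Fin n → ℝ) (L : ℕ) (ω : Ω) : Prop where
  embedding : IsTypicalUpdate q d u 0 (oneHot T.tok) (T.hidden 0 ω)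
  colNormSq_headOut_le : ∀ ℓ < L, ∀ t, q * colNormSq (T.headOut ℓ ω) t ≤ d
  attention : ∀ ℓ < L, IsTypicalUpdate q 1 u (T.hidden ℓ ω) (T.headOut ℓ ω) (T.hiddenAtt ℓ ω)
  mlp : ∀ ℓ < L, IsTypicalUpdate q (d * (k : ℝ)⁻¹) u (T.hiddenAtt ℓ ω) (T.B ℓ ω)
    (T.hidden (ℓ + 1) ω)
  stableRank_B_le : ∀ ℓ < L, stableRank (T.B ℓ ω) ≤ Cprop * stableRank (T.rmsMlp ℓ ω)
  colNormSq_B_le : ∀ ℓ < L, ∀ t, colNormSq (T.B ℓ ω) t ≤ m * k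

namespace GaussianInit

variable {T} [MeasurableSpace Ω] {μ : Measure Ω} {L ℓ : ℕ} {ε : ℝ}

lemma measureReal_not_embedding_le (hT : T.GaussianInit μ L) (hε0 : 0 ≤ ε) (hε1 : ε ≤ 1)
    (u : Fin n → ℝ) :
    μ.real {ω | ¬ IsTypicalUpdate (1 - ε) d u 0 (oneHot T.tok) (T.hidden 0 ω)} ≤
      (n + 1) * Real.exp (-(ε ^ 2 * d / 16)) := by
  have := hT.indep.isProbabilityMeasure
  simpa [hidden_zero_eq] using hT.isGaussianMatrix_E.measureReal_not_isTypicalUpdate_le one_ne_zero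
    hε0 hε1 (X := fun _ => 0) (H := fun _ => oneHot T.tok) (fun _ _ => measurable_const)
    (fun _ _ => measurable_const) (indepFun_const_left _ _) u

lemma measureReal_not_headOut_le (hT : T.GaussianInit μ L) (hε0 : 0 ≤ ε) (hε1 : ε ≤ 1)
    (hd : 0 < d) (hℓ : ℓ < L) :
    μ.real {ω | ¬ ∀ t, (1 - ε) * colNormSq (T.headOut ℓ ω) t ≤ d} ≤
      n * Real.exp (-(ε ^ 2 * d / 16)) := by
  have := hT.indep.isProbabilityMeasure
  have hd' : (0 : ℝ) < d := by exact_mod_cast hd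
  have hmixed := hT.measurable_mixed hℓ (hT.measurable_hidden hℓ.le)
  have hcol : ∀ t, μ.real {ω | ¬ (1 - ε) * colNormSq (T.headOut ℓ ω) t ≤ d} ≤
      Real.exp (-(ε ^ 2 * d / 16)) := fun t => by
    have h := (hT.isGaussianMatrix_stackedWV hℓ).measureReal_rows_upper_le_of_indepFun
      (by simpa using hd.ne') hε0 hε1 (s := 1)
      (b := fun ω i j => T.mixed ℓ (headRow T.head_dvd i).1 ω j t) (by fun_prop)
      (fun ω i => by
        rw [NNReal.coe_inv, NNReal.coe_natCast, inv_mul_le_iff₀ hd', mul_one]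
        exact colNormSq_mul_le_of_stdSimplex (colNormSq_rmsNorm_le _) (hT.stochastic ℓ hℓ _ ω t))
      (hT.indepFun_mixed_stackedWV hℓ t)
    simp only [Fintype.card_fin, mul_one, ← not_le] at h
    exact h
  simpa using measureReal_not_forall_le hcol

lemma measureReal_not_attention_le (hT : T.GaussianInit μ L) (hε0 : 0 ≤ ε) (hε1 : ε ≤ 1)
    (hd : 0 < d) (hℓ : ℓ < L) (u : Fin n → ℝ) :
    μ.real {ω | ¬ IsTypicalUpdate (1 - ε) 1 u (T.hidden ℓ ω) (T.headOut ℓ ω) (T.hiddenAtt ℓ ω)} ≤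
      (n + 1) * Real.exp (-(ε ^ 2 * d / 16)) := by
  have hd' : (d : ℝ) ≠ 0 := by exact_mod_cast hd.ne'
  have hX := hT.measurable_hidden hℓ.le
  simpa [hiddenAtt_eq, hd'] using
    (hT.isGaussianMatrix_WO hℓ).measureReal_not_isTypicalUpdate_le (by simpa using hd.ne') hε0 hε1
      hX (hT.measurable_headOut hℓ hX) (hT.indepFun_hidden_headOut_WO hℓ) u

lemma measureReal_not_mlp_le (hT : T.GaussianInit μ L) (hε0 : 0 ≤ ε) (hε1 : ε ≤ 1)
    (hk : 0 < k) (hℓ : ℓ < L) (u : Fin n → ℝ) :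
    μ.real {ω | ¬ IsTypicalUpdate (1 - ε) (d * (k : ℝ)⁻¹) u (T.hiddenAtt ℓ ω) (T.B ℓ ω)
      (T.hidden (ℓ + 1) ω)} ≤ (n + 1) * Real.exp (-(ε ^ 2 * d / 16)) := by
  simpa [hidden_succ_eq] using
    (hT.isGaussianMatrix_W2 hℓ).measureReal_not_isTypicalUpdate_le (by simpa using hk.ne') hε0 hε1
      (hT.measurable_hiddenAtt hℓ) (hT.measurable_B ℓ hℓ) (hT.indep_B ℓ hℓ) u

end GaussianInit

end Transformer

lemma PropagationInterface.measureReal_not_le {Ω : Type*} [MeasurableSpace Ω] {μ : Measure Ω}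
    [IsProbabilityMeasure μ] {d k n : ℕ} {X : Ω → Matrix (Fin d) (Fin n) ℝ}
    {B : Ω → Matrix (Fin k) (Fin n) ℝ} {Cprop m p : ℝ}
    (h : PropagationInterface μ X B Cprop m p) (hX : ∀ i t, Measurable fun ω => X ω i t)
    (hB : ∀ i t, Measurable fun ω => B ω i t) :
    μ.real {ω | ¬ (stableRank (B ω) ≤ Cprop * stableRank (rmsNorm (X ω)) ∧
      ∀ t, colNormSq (B ω) t ≤ m * k)} ≤ 1 - p := by
  have hstable : MeasurableSet {ω | stableRank (B ω) ≤ Cprop * stableRank (rmsNorm (X ω))} :=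
    measurableSet_le (measurable_stableRank hB)
      ((measurable_stableRank (measurable_rmsNorm hX)).const_mul _)
  have hcol : MeasurableSet {ω | ∀ t, colNormSq (B ω) t ≤ m * k} :=
    measurableSet_setOfPred.2 <| Measurable.forall fun t =>
      measurableSet_setOfPred.1 (measurableSet_le (measurable_colNormSq hB t) measurable_const)
  exact (probReal_compl_eq_one_sub (μ := μ) (hstable.inter hcol)).trans_le
    (sub_le_sub_left h.prob 1)

namespace Transformer

variable {Ω : Type*} [MeasurableSpace Ω] {μ : Measure Ω}
  {V d nHead k n L : ℕ} {T : Transformer Ω V d nHead k n} {ε Cprop m p : ℝ}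

lemma GaussianInit.measureReal_not_isTypical_le (hT : T.GaussianInit μ L) (hε0 : 0 ≤ ε)
    (hε1 : ε ≤ 1) (hd : 0 < d) (hk : 0 < k)
    (h : ∀ ℓ < L, PropagationInterface μ (T.hiddenAtt ℓ) (T.B ℓ) Cprop m p) (u : Fin n → ℝ) :
    μ.real {ω | ¬ T.IsTypical (1 - ε) Cprop m u L ω} ≤
      (n + 1) * Real.exp (-(ε ^ 2 * d / 16)) +
        L * ((3 * n + 2) * Real.exp (-(ε ^ 2 * d / 16)) + (1 - p)) := by
  have := hT.indep.isProbabilityMeasure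
  have hlayer := fun ℓ : Fin L => (measureReal_not_and_le _ _).trans (add_le_add
    (hT.measureReal_not_headOut_le hε0 hε1 hd ℓ.2) ((measureReal_not_and_le _ _).trans (add_le_add
      (hT.measureReal_not_attention_le hε0 hε1 hd ℓ.2 u) ((measureReal_not_and_le _ _).trans
        (add_le_add (hT.measureReal_not_mlp_le hε0 hε1 hk ℓ.2 u) ((h ℓ ℓ.2).measureReal_not_le
          (hT.measurable_hiddenAtt ℓ.2) (hT.measurable_B ℓ ℓ.2)))))))
  have hunion := (measureReal_not_and_le _ _).trans (add_le_add
    (hT.measureReal_not_embedding_le hε0 hε1 u) (measureReal_not_forall_le hlayer))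
  refine (measureReal_mono fun _ => mt fun ⟨hE, hl⟩ => ⟨hE, fun ℓ hℓ => (hl ⟨ℓ, hℓ⟩).1,
    fun ℓ hℓ => (hl ⟨ℓ, hℓ⟩).2.1, fun ℓ hℓ => (hl ⟨ℓ, hℓ⟩).2.2.1,
    fun ℓ hℓ => (hl ⟨ℓ, hℓ⟩).2.2.2.1, fun ℓ hℓ => (hl ⟨ℓ, hℓ⟩).2.2.2.2⟩).trans
    (hunion.trans_eq ?_)
  rw [Fintype.card_fin]
  ring

end Transformer

lemma div_sq_pow_mul_le {n d P q r κ : ℝ} {a N : ℕ} (hn : 0 < n) (hd : 0 < d) (hP : 0 < P)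
    (hr : 0 ≤ r) (hq0 : 0 < q) (hq1 : q ≤ 1) (hκ : 1 ≤ κ * q ^ N) (ha : 2 * a ≤ N) :
    n * (d * r) * (n * P) / ((q ^ a) ^ 2 * (d * (n * P) ^ 2)) ≤ r * (κ / P) := by
  have hpow : q ^ N ≤ (q ^ a) ^ 2 := by
    rw [← pow_mul']
    exact pow_le_pow_of_le_one hq0.le hq1 ha
  have hκ0 : 0 < κ := pos_of_mul_pos_left (zero_lt_one.trans_le hκ) (pow_pos hq0 N).le
  have hκa : 1 ≤ κ * (q ^ a) ^ 2 := hκ.trans (mul_le_mul_of_nonneg_left hpow hκ0.le)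
  calc n * (d * r) * (n * P) / ((q ^ a) ^ 2 * (d * (n * P) ^ 2)) = r / P / (q ^ a) ^ 2 := by
        field_simp
    _ ≤ r / P * κ := by
        rw [div_le_iff₀ (by positivity), mul_assoc]
        exact le_mul_of_one_le_right (by positivity) hκa
    _ = r * (κ / P) := by ring

namespace Transformer

variable {Ω : Type*} {V d nHead k n L : ℕ} {T : Transformer Ω V d nHead k n} {Cprop m q κ : ℝ}
  {j : Fin V} {ω : Ω}

/-- The stable ranks up to layer `L` are bounded by `κ / pMax` times affine functions of the depth,
those of the MLP intermediates `B` with the additional factor `Cprop`. -/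
structure HasLinearGrowth (T : Transformer Ω V d nHead k n) (κ Cprop m : ℝ) (L : ℕ) (ω : Ω) :
    Prop where
  stableRank_hidden_zero_le : stableRank (T.hidden 0 ω) ≤ κ / pMax T.tok
  stableRank_rms_le : ∀ ℓ ≤ L, stableRank (T.rms ℓ ω) ≤ (1 + (1 + m) * ℓ) * (κ / pMax T.tok)
  stableRank_rmsMlp_le : ∀ ℓ < L,
    stableRank (T.rmsMlp ℓ ω) ≤ (2 + (1 + m) * ℓ) * (κ / pMax T.tok)
  stableRank_B_le : ∀ ℓ < L,
    stableRank (T.B ℓ ω) ≤ Cprop * ((2 + (1 + m) * ℓ) * (κ / pMax T.tok))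

namespace IsTypical

lemma normControl_hiddenAtt {ℓ : ℕ} {R Q : ℝ} {u : Fin n → ℝ} (h : T.IsTypical q Cprop m u L ω)
    (hq0 : 0 ≤ q) (hq1 : q ≤ 1) (hℓ : ℓ < L)
    (hX : NormControl (q ^ (3 * ℓ + 1)) R Q u (T.hidden ℓ ω)) :
    NormControl (q ^ (3 * ℓ + 3)) (R + d) Q u (T.hiddenAtt ℓ ω) := by
  have := hX.update (a := q) (c := d) (h.attention ℓ hℓ) (by positivity) (pow_le_one₀ hq0 hq1)
    hq0 hq1 hq0 zero_le_one (by simpa using h.colNormSq_headOut_le ℓ hℓ)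
  convert this using 1
  ring

lemma normControl_hidden (h : T.IsTypical q Cprop m (oneHot T.tok j) L ω) (hk : 0 < k)
    (hq0 : 0 ≤ q) (hq1 : q ≤ 1) {ℓ : ℕ} (hℓ : ℓ ≤ L) :
    NormControl (q ^ (3 * ℓ + 1)) (d * (1 + (1 + m) * ℓ)) (d * sqNorm (oneHot T.tok j) ^ 2)
      (oneHot T.tok j) (T.hidden ℓ ω) := by
  induction ℓ with
  | zero => simpa using h.embedding.normControl_oneHot hq0 (Nat.cast_nonneg d)
  | succ ℓ ih =>
    have hk' : (0 : ℝ) < k := by exact_mod_cast hk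
    have hB : ∀ t, 1 * (d * (k : ℝ)⁻¹ * colNormSq (T.B ℓ ω) t) ≤ d * m := fun t => by
      rw [one_mul, mul_assoc]
      gcongr
      rw [inv_mul_le_iff₀ hk', mul_comm]
      exact h.colNormSq_B_le ℓ hℓ t
    have hAtt := h.normControl_hiddenAtt hq0 hq1 hℓ (ih (Nat.le_of_succ_le hℓ))
    have hMlp := hAtt.update (h.mlp ℓ hℓ) (by positivity) (pow_le_one₀ hq0 hq1) zero_le_one le_rfl
      hq0 (by positivity) hB
    convert hMlp using 1
    · ring
    · push_cast
      ring

lemma hasLinearGrowth (h : T.IsTypical q Cprop m (oneHot T.tok j) L ω) (hL : 0 < L) (hd : 0 < d)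
    (hk : 0 < k) (hn : 0 < n) (hm : 0 ≤ m) (hC : 0 ≤ Cprop) (hq0 : 0 < q) (hq1 : q ≤ 1)
    (hκ : 1 ≤ κ * q ^ (8 * L)) (hj : sqNorm (oneHot T.tok j) = n * pMax T.tok) :
    T.HasLinearGrowth κ Cprop m L ω := by
  have hd' : (0 : ℝ) < d := by exact_mod_cast hd
  have hn' : (0 : ℝ) < n := by exact_mod_cast hn
  have hp := pMax_pos hn T.tok
  have hQ : 0 < d * sqNorm (oneHot T.tok j) ^ 2 := by rw [hj]; positivity
  have hhidden := fun {ℓ : ℕ} (hℓ : ℓ ≤ L) => h.normControl_hidden hk hq0.le hq1 hℓ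
  have hsimp : ∀ {r y : ℝ} {a : ℕ}, 0 ≤ r → 2 * a ≤ 8 * L → y ≤ n * (d * r) *
      sqNorm (oneHot T.tok j) / ((q ^ a) ^ 2 * (d * sqNorm (oneHot T.tok j) ^ 2)) →
      y ≤ r * (κ / pMax T.tok) := fun hr ha hy => hy.trans <| by
    rw [hj]
    exact div_sq_pow_mul_le hn' hd' hp hr hq0 hq1 hκ ha
  have hmlp : ∀ ℓ < L, stableRank (T.rmsMlp ℓ ω) ≤ (2 + (1 + m) * ℓ) * (κ / pMax T.tok) :=
    fun ℓ hℓ => hsimp (by positivity) (by lia : 2 * (3 * ℓ + 3) ≤ 8 * L) <| by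
      have hAtt := h.normControl_hiddenAtt hq0.le hq1 hℓ (hhidden hℓ.le)
      refine (hAtt.stableRank_rmsNorm_le (by positivity) hQ hd).trans_eq ?_
      congr 3
      ring
  refine ⟨?_, fun ℓ hℓ => ?_, hmlp, fun ℓ hℓ => ?_⟩
  · simpa using hsimp (r := 1 + (1 + m) * (0 : ℕ)) (a := 3 * 0 + 1) (by simp) (by lia)
      ((hhidden L.zero_le).stableRank_le (by positivity) hQ)
  · exact hsimp (by positivity) (by lia)
      ((hhidden hℓ).stableRank_rmsNorm_le (by positivity) hQ hd)
  · exact (h.stableRank_B_le ℓ hℓ).trans (mul_le_mul_of_nonneg_left (hmlp ℓ hℓ) hC)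

end IsTypical

end Transformer

lemma mul_exp_neg_two_mul_le {N x : ℝ} (hN : 0 < N) (hx : Real.log N ≤ x) :
    N * Real.exp (-(2 * x)) ≤ Real.exp (-x) := by
  have hNx : N ≤ Real.exp x := (Real.log_le_iff_le_exp hN).1 hx
  calc N * Real.exp (-(2 * x)) ≤ Real.exp x * Real.exp (-(2 * x)) := by gcongr
    _ = Real.exp (-x) := by
      rw [← Real.exp_add]
      ring_nf

lemma union_bound_le {L n : ℕ} {d E : ℝ} (hL : 1 ≤ L) (hn : 1 ≤ n)
    (hd : 32000000 * (L : ℝ) ^ 2 * Real.log (n * L) ≤ d)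
    (hE : E = Real.exp (-((1 / (1000 * (L : ℝ))) ^ 2 * d / 16))) :
    (n + 1) * E + L * ((3 * n + 2) * E) ≤
      32000000 * L * Real.exp (-(1 / 32000000) * (d / (L : ℝ) ^ 2)) := by
  have hL' : (1 : ℝ) ≤ L := by exact_mod_cast hL
  have hn' : (1 : ℝ) ≤ n := by exact_mod_cast hn
  set x : ℝ := 1 / 32000000 * (d / (L : ℝ) ^ 2) with hx
  have hlog : Real.log (n * L) ≤ x := by
    rw [hx, mul_div_assoc', le_div_iff₀ (by positivity)]
    linarith
  have hE' : E = Real.exp (-(2 * x)) := by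
    rw [hE, hx]
    congr 1
    field_simp
    ring
  have hcount : (n + 1 + L * (3 * n + 2) : ℝ) ≤ 7 * (n * L) := by nlinarith
  calc (n + 1) * E + L * ((3 * n + 2) * E) = (n + 1 + L * (3 * n + 2)) * E := by ring
    _ ≤ 7 * (n * L) * E := by
      rw [hE']
      gcongr
    _ = 7 * (n * L * E) := by ring
    _ ≤ 7 * Real.exp (-x) := by
      rw [hE']
      exact mul_le_mul_of_nonneg_left (mul_exp_neg_two_mul_le (by positivity) hlog) (by norm_num)
    _ ≤ 32000000 * L * Real.exp (-x) := by
      gcongr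
      linarith
    _ = _ := by rw [neg_mul]

lemma one_le_mul_one_sub_pow {L : ℕ} (hL : 1 ≤ L) :
    1 ≤ 1.01 * (1 - 1 / (1000 * L) : ℝ) ^ (8 * L) := by
  have hL' : (1 : ℝ) ≤ L := by exact_mod_cast hL
  have hε : 1 / (1000 * L : ℝ) ≤ 1 := (div_le_one (by positivity)).2 (by linarith)
  have hbernoulli := one_add_mul_le_pow (a := -(1 / (1000 * L) : ℝ)) (by linarith) (8 * L)
  have hLε : ((8 * L : ℕ) : ℝ) * -(1 / (1000 * L)) = -(8 / 1000) := by
    push_cast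
    field_simp
  simp only [hLε, ← sub_eq_add_neg] at hbernoulli
  linarith

lemma mul_le_mul_mul_pow {a b y ρ : ℝ} (hb : 0 ≤ b) (hab : a ≤ b) (hy : 0 ≤ y) (hρ : 1 ≤ ρ)
    (ℓ : ℕ) : a * y ≤ b * y * ρ ^ ℓ :=
  (mul_le_mul_of_nonneg_right hab hy).trans
    (le_mul_of_one_le_right (mul_nonneg hb hy) (one_le_pow₀ hρ))

namespace Transformer.HasLinearGrowth

variable {Ω : Type*} {V d nHead k n L : ℕ} {T : Transformer Ω V d nHead k n} {κ Cprop m ρ : ℝ}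
  {ω : Ω}

lemma stableRank_rms_le_mul_pow (h : T.HasLinearGrowth κ Cprop m L ω) (hn : 0 < n) (hm : 0 ≤ m)
    (hκ : 0 ≤ κ) (hρ : 1 ≤ ρ) {ℓ : ℕ} (hℓ : ℓ ≤ L) :
    stableRank (T.rms ℓ ω) ≤ (1.02 + 1.02 * (1 + m) * ℓ) * (κ / pMax T.tok) * ρ ^ ℓ := by
  have hmℓ : 0 ≤ (1 + m) * ℓ := by positivity
  exact (h.stableRank_rms_le ℓ hℓ).trans <| mul_le_mul_mul_pow (by positivity) (by linarith)
    (div_nonneg hκ (pMax_pos hn T.tok).le) hρ ℓ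

lemma stableRank_rmsMlp_le_mul_pow (h : T.HasLinearGrowth κ Cprop m L ω) (hn : 0 < n)
    (hm : 0 ≤ m) (hκ : 0 ≤ κ) (hρ : 1 ≤ ρ) {ℓ : ℕ} (hℓ : ℓ < L) :
    stableRank (T.rmsMlp ℓ ω) ≤ (6.13 + 3.09 * (1 + m) * ℓ) * (κ / pMax T.tok) * ρ ^ ℓ := by
  have hmℓ : 0 ≤ (1 + m) * ℓ := by positivity
  exact (h.stableRank_rmsMlp_le ℓ hℓ).trans <| mul_le_mul_mul_pow (by positivity) (by linarith)
    (div_nonneg hκ (pMax_pos hn T.tok).le) hρ ℓ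

lemma stableRank_B_le_mul_pow (h : T.HasLinearGrowth κ Cprop m L ω) (hn : 0 < n) (hm : 0 ≤ m)
    (hC : 0 ≤ Cprop) (hκ : 0 ≤ κ) (hρ : 1 ≤ ρ) {ℓ : ℕ} (hℓ : ℓ < L) :
    stableRank (T.B ℓ ω) ≤
      Cprop * (6.13 + 3.09 * (1 + m) * ℓ) * (κ / pMax T.tok) * ρ ^ ℓ := by
  have hmℓ : 0 ≤ (1 + m) * ℓ := by positivity
  refine (h.stableRank_B_le ℓ hℓ).trans ?_
  rw [← mul_assoc]
  exact mul_le_mul_mul_pow (by positivity) (mul_le_mul_of_nonneg_left (by linarith) hC)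
    (div_nonneg hκ (pMax_pos hn T.tok).le) hρ ℓ

lemma stableRank_rms_zero_le (h : T.HasLinearGrowth κ Cprop m L ω) :
    stableRank (T.rms 0 ω) ≤ κ / pMax T.tok := by
  simpa using h.stableRank_rms_le 0 L.zero_le

lemma stableRank_rmsMlp_zero_le (h : T.HasLinearGrowth κ Cprop m L ω) (hL : 0 < L) :
    stableRank (T.rmsMlp 0 ω) ≤ 2 * κ / pMax T.tok := by
  simpa [mul_div_assoc] using h.stableRank_rmsMlp_le 0 hL

end Transformer.HasLinearGrowth

-- `32000000 = 2 * 16 * 1000 ^ 2`: with `ε = 1 / (1000 * L)` the tails are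
-- `exp (-(ε ^ 2 * d / 16))`, and half of that exponent absorbs the number of events in the union
-- bound.
theorem mainTheorem4_general :
    ∃ c C : ℝ, 0 < c ∧ 0 < C ∧
      ∀ (L nHead d k n V : ℕ), 1 ≤ L → 1 ≤ d → 1 ≤ k → 1 ≤ n →
      ∀ (Ω : Type*) [MeasurableSpace Ω] (μ : Measure Ω) [IsProbabilityMeasure μ]
        (T : Transformer Ω V d nHead k n), T.GaussianInit μ L →
      ∀ (Cprop m p : ℝ),
        (∀ ℓ < L, PropagationInterface μ (T.hiddenAtt ℓ) (T.B ℓ) Cprop m p) →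
      C * (L : ℝ) ^ 2 * Real.log (n * L) ≤ d →
      1 - C * L * Real.exp (-c * (d / (L : ℝ) ^ 2)) - L * (1 - p) ≤
        μ.real {ω | T.HasLinearGrowth 1.01 Cprop m L ω} := by
  refine ⟨1 / 32000000, 32000000, by norm_num, by norm_num, ?_⟩
  intro L nHead d k n V hL hd hk hn Ω _ μ _ T hT Cprop m p hprop hdL
  have hL' : (1 : ℝ) ≤ L := by exact_mod_cast hL
  have hε1 : 1 / (1000 * L : ℝ) < 1 := (div_lt_one (by positivity)).2 (by linarith)
  obtain ⟨j, hj⟩ := exists_sqNorm_oneHot_row_eq hn T.tok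
  have hgood := fun ω (h : T.IsTypical (1 - 1 / (1000 * L : ℝ)) Cprop m (oneHot T.tok j) L ω) =>
    h.hasLinearGrowth hL hd hk hn (hprop 0 hL).m_nonneg
      (zero_le_one.trans (hprop 0 hL).one_le_Cprop) (sub_pos.2 hε1)
      (sub_le_self 1 (by positivity)) (one_le_mul_one_sub_pow hL) hj
  have hbad := hT.measureReal_not_isTypical_le (by positivity) hε1.le hd hk hprop (oneHot T.tok j)
  have hunion := union_bound_le hL hn hdL rfl
  refine le_trans ?_ (one_sub_measureReal_not_le hgood)
  linarith

end StableRank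

end

open StableRank in
theorem mainTheorem4 :
    ∃ c C : ℝ, 0 < c ∧ 0 < C ∧
      ∀ (L nHead d k n V : ℕ), 1 ≤ L → 1 ≤ nHead → 1 ≤ d → 1 ≤ k → 1 ≤ n →
      ∀ (Ω : Type*) [MeasurableSpace Ω] (μ : MeasureTheory.Measure Ω)
        [MeasureTheory.IsProbabilityMeasure μ]
        (T : StableRank.Transformer Ω V d nHead k n), T.GaussianInit μ L →
      ∀ (Cprop m p : ℝ),
        (∀ ℓ < L, StableRank.PropagationInterface μ (T.hiddenAtt ℓ) (T.B ℓ) Cprop m p) →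
      C * (L : ℝ) ^ 2 * Real.log (n * L) ≤ d →
      C * (L : ℝ) ^ 2 * Real.log (n * L) ≤ k →
      ∀ (ρ : ℝ), ρ = 3.1 * (1 + m) →
      1 - C * L * Real.exp (-c * (d / (L : ℝ) ^ 2)) - L * (1 - p) ≤
        μ.real {ω |
          (StableRank.stableRank (T.hidden 0 ω) ≤ 1.01 / StableRank.pMax T.tok ∧
            StableRank.stableRank (T.rms 0 ω) ≤ 1.03 / StableRank.pMax T.tok ∧
            StableRank.stableRank (T.rmsMlp 0 ω) ≤ 6.03 / StableRank.pMax T.tok) ∧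
          (∀ ℓ < L,
            StableRank.stableRank (T.rms ℓ ω) ≤
              (1.02 + 1.02 * (1 + m) * ℓ) * (1.01 / StableRank.pMax T.tok) * ρ ^ ℓ ∧
            StableRank.stableRank (T.rmsMlp ℓ ω) ≤
              (6.13 + 3.09 * (1 + m) * ℓ) * (1.01 / StableRank.pMax T.tok) * ρ ^ ℓ ∧
            StableRank.stableRank (T.B ℓ ω) ≤
              Cprop * (6.13 + 3.09 * (1 + m) * ℓ) * (1.01 / StableRank.pMax T.tok) * ρ ^ ℓ) ∧
          StableRank.stableRank (T.rms L ω) ≤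
            (1.02 + 1.02 * (1 + m) * L) * (1.01 / StableRank.pMax T.tok) * ρ ^ L} := by
  obtain ⟨c, C, hc, hC, hgrowth⟩ := mainTheorem4_general
  refine ⟨c, C, hc, hC, ?_⟩
  intro L nHead d k n V hL _ hd hk hn Ω _ μ _ T hT Cprop m p hprop hdL _ ρ hρ
  have hm := (hprop 0 hL).m_nonneg
  have hC0 : 0 ≤ Cprop := zero_le_one.trans (hprop 0 hL).one_le_Cprop
  have hκ : (0 : ℝ) ≤ 1.01 := by norm_num
  have hρ1 : 1 ≤ ρ := by linarith
  have hp := pMax_pos hn T.tok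
  refine (hgrowth L nHead d k n V hL hd hk hn Ω μ T hT Cprop m p hprop hdL).trans
    (measureReal_mono fun ω h => ⟨⟨h.stableRank_hidden_zero_le, ?_, ?_⟩, fun ℓ hℓ => ⟨?_, ?_, ?_⟩,
      h.stableRank_rms_le_mul_pow hn hm hκ hρ1 le_rfl⟩)
  · exact h.stableRank_rms_zero_le.trans (by gcongr; norm_num)
  · exact (h.stableRank_rmsMlp_zero_le hL).trans (by gcongr; norm_num)
  · exact h.stableRank_rms_le_mul_pow hn hm hκ hρ1 hℓ.le
  · exact h.stableRank_rmsMlp_le_mul_pow hn hm hκ hρ1 hℓ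
  · exact h.stableRank_B_le_mul_pow hn hm hC0 hκ hρ1 hℓ
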